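/- **Proposition 6.1.** Setting. Let $Z$ be a construction, given by its surface of points: a Hausdorff topological surface with a flat structure modelled on the standard apartment $A\cong\mathbb R^2$ for $SL(3)$ with its six directions of walls (changes of flat charts are Euclidean isometries permuting the six directions), except at isolated conical points. Thus every point $z$ has a neighbourhood which is a cone of $n$ flat sectors of angle $60^\circ$, $n\in\{4,6,8\}$, with $n$ germs of edges at $z$ (in wall directions) separating the sectors; all points near $z$, other than $z$, have $n=6$. (Completeness or simple connectivity of $Z$ need not be assumed.) An *oriented scaffolding* marks each edge of $Z$ as open or folded, the fold edges being those contained in a discrete collection of straight edges, and orients each fold edge. Number the edge germs at a point with $n$ sectors cyclically by $\mathbb Z/n$. The local picture at a point is *standard* if, up to rotation and reflection of the numbering, it is one of the following ("in"/"out" denote fold edges oriented towards/away from the point, all other germs being open): - ${\bf 6}_0$: $n=6$, no fold edges; ${\bf 6}_2$: $n=6$, in $0$, out $3$; ${\bf 6}_3$: $n=6$, in $0,2$, out $4$; ${\bf 6}_4$: $n=6$, in $0,2$, out $3,4$; - ${\bf 8}_0$: $n=8$, no fold edges; ${\bf 8}_1$: $n=8$, out $0$; ${\bf 8}_2$: $n=8$,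 out $0,4$; ${\bf 8}'_2$: $n=8$, out $0,1$; - ${\bf 4}_2$: $n=4$, in $0,2$. A *singularity* is a point that is of type neither ${\bf 6}_0$ nor ${\bf 6}_2$. A *BPS state* of the refracting spectral network is a map to $Z$ of a nonempty compact (i.e. finite) graph, closed loops being allowed, such that: its edges go to segments in wall directions that do not go along fold edges, that pass only through ${\bf 6}_0$ and ${\bf 6}_2$ points in their interior, and that are straight except that on crossing a fold edge (at a ${\bf 6}_2$ point) from either direction on one side they may continue in either of the two wall directions on the other side; its vertices are either trivalent, going to ${\bf 6}_0$ points with the three edges leaving at mutual angles $120^\circ$, or endpoints, going to singularities with the adjoining edge leaving in a non-fold direction. Statement. Suppose that the local picture of the oriented scaffolding is standard at every point of $Z$, and that the refracting spectral network has no BPS states. Form the directed graph whose vertices are the singularities, except that each ${\bf 6}_4$ point gives two vertices; and whose edges are the fold edges joining two singularities (maximal straight fold segments whose interior points are all of type ${\bf 6}_2$), with their orientations. At a ${\bf 6}_4$ point the two opposite fold edges (the "spine") are attached to one of the two vertices, and the other two fold edges are attached to the other. Then this directed graph has no directed loops, i.e. no closed directed path of positive length. -/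

import Mathlib

open Filter Topology

noncomputable section

namespace SpectralNetwork

/-- The cone obtained by gluing `m` flat sectors of angle `60°` cyclically around an apex
(used for `m = 4, 6, 8`).  The `m` edges issuing from the apex are indexed by `ZMod m`; a point of
the sector between the edges `i` and `i + 1` is the combination `x i • e i + x (i+1) • e (i+1)` of
the unit vectors along these two edges, and is recorded by its coordinate function `x`. -/
abbrev Cone (m : ℕ) : Type :=
  {x : ZMod m → ℝ // (∀ i, 0 ≤ x i) ∧ ∃ i, ∀ j, x j ≠ 0 → j = i ∨ j = i + 1}

/-- The apex of the cone. -/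
def Cone.apex (m : ℕ) : Cone m :=
  ⟨0, fun _ => le_rfl, 0, fun _ h => absurd rfl h⟩

/-- The point at distance `t` from the apex on the edge `i` (for `t ≥ 0`). -/
def Cone.ray {m : ℕ} (i : ZMod m) (t : ℝ) : Cone m :=
  ⟨Pi.single i (max t 0), fun j => by
      by_cases h : j = i
      · subst h; simp
      · simp [Pi.single_eq_of_ne h],
    i, fun j hj => by
      by_contra h
      exact hj (Pi.single_eq_of_ne (fun e => h (Or.inl e)) _)⟩

/-- Flat coordinates on the open star `{x | 0 < x i}` of the edge `i` (the union of the two sectors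
adjacent to that edge).  The pair `(u, v)` stands for the vector `u • ε₀ + v • ε₁` of the Euclidean
plane, where `ε₀`, `ε₁` are unit vectors with angle `60°`: the three consecutive edges
`i - 1`, `i`, `i + 1` are laid out along `ε₀ - ε₁`, `ε₀`, `ε₁`. -/
def Cone.starCoord {m : ℕ} (i : ZMod m) (x : Cone m) : ℝ × ℝ :=
  (x.1 i + x.1 (i - 1), x.1 (i + 1) - x.1 (i - 1))

/-- For `m = 6` and `s = ±1`: the identification of the whole cone with the Euclidean plane, which
is the standard apartment, in which the edges `a, a + s, a + 2s, …, a + 5s` are laid out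
along `ε₀, ε₁, ε₁ - ε₀, -ε₀, -ε₁, ε₀ - ε₁`. -/
def Cone.hexCoord {m : ℕ} (a s : ZMod m) (x : Cone m) : ℝ × ℝ :=
  (x.1 a - x.1 (a + 2 * s) - x.1 (a + 3 * s) + x.1 (a + 5 * s),
   x.1 (a + s) + x.1 (a + 2 * s) - x.1 (a + 4 * s) - x.1 (a + 5 * s))

/-- A construction, given through its surface of points: a surface locally modelled, with its
three directions of walls, on the standard apartment for `SL(3)`, except at isolated conical points
with `4` or `8` sectors.  Each point `z` has a chart identifying a neighbourhood of `z` with an open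
neighbourhood of the apex of the cone with `sectors z` sectors; so the link of `z` is a polygon with
`sectors z` edges, and the germs of edges at `z` are indexed by `ZMod (sectors z)`.
All other points of the chart are flat (`6` sectors), and there the change of charts is a Euclidean
isometry of the plane that permutes the six directions of edges. -/
structure Construction (Z : Type*) [TopologicalSpace Z] where
  sectors : Z → ℕ
  sectors_eq : ∀ z, sectors z = 4 ∨ sectors z = 6 ∨ sectors z = 8
  chart : ∀ z, OpenPartialHomeomorph Z (Cone (sectors z))
  mem_source : ∀ z, z ∈ (chart z).source
  chart_self : ∀ z, chart z z = Cone.apex (sectors z)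
  compatible : ∀ z, ∀ w ∈ (chart z).source, ∀ i, 0 < (chart z w).1 i →
    sectors w = 6 ∧ ∃ a s : ZMod (sectors w), (s = 1 ∨ s = -1) ∧
      ∀ᶠ u in 𝓝 w, Cone.starCoord i (chart z u) =
        Cone.starCoord i (chart z w) + Cone.hexCoord a s (chart w u)

namespace Construction

variable {Z : Type*} [TopologicalSpace Z] (X : Construction Z)

/-- The point at (small) distance `t` from `z` along the edge germ `i` at `z`. -/
def ray (z : Z) (i : ZMod (X.sectors z)) (t : ℝ) : Z :=
  (X.chart z).symm (Cone.ray i t)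

/-- The path `c` passes straight through the flat point `c t`, leaving it along the edge germ `k`
(and having arrived along the opposite one). -/
def IsStraightAt (c : ℝ → Z) (t : ℝ) (k : ZMod (X.sectors (c t))) : Prop :=
  X.sectors (c t) = 6 ∧
    ∀ᶠ s in 𝓝[≥] (0 : ℝ), c (t + s) = X.ray (c t) k s ∧ c (t - s) = X.ray (c t) (k + 3) s

/-- There is a straight segment (in the direction of the walls, parametrized by arc length, of
positive length) that leaves `p` along the edge germ `i` at `p` and ends at `q` along the
edge germ `j` at `q`, such that each interior point `z` and the forward direction `k` of the segment
at `z` satisfy `P z k`. -/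
def Segment (P : ∀ z, ZMod (X.sectors z) → Prop)
    (p : Z) (i : ZMod (X.sectors p)) (q : Z) (j : ZMod (X.sectors q)) : Prop :=
  ∃ (L : ℝ) (c : ℝ → Z), 0 < L ∧
    (∀ᶠ s in 𝓝[≥] (0 : ℝ), c s = X.ray p i s) ∧
    (∀ᶠ s in 𝓝[≥] (0 : ℝ), c (L - s) = X.ray q j s) ∧
    ∀ t ∈ Set.Ioo 0 L, ∃ k, X.IsStraightAt c t k ∧ P (c t) k

end Construction

/-- Marking of a germ of edge at a point: unfolded (open), or folded and oriented towards the point,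
or folded and oriented away from the point. -/
inductive EdgeMark
  | unfolded
  | inward
  | outward

/-- The marking of the same edge seen from the other side. -/
def EdgeMark.reverse : EdgeMark → EdgeMark
  | unfolded => unfolded
  | inward => outward
  | outward => inward

/-- An oriented scaffolding: each germ of edge is marked as open or folded, fold edges are oriented,
and the marking comes from a discrete collection of straight oriented edges.  That is, near
each point `z` the fold edges are exactly the straight edges prolonging the folded germs at `z`:
at a nearby point on the edge `i`, the forward direction `k` has the mark of `i`, the backward
direction `k + 3` has the reversed mark, and nothing else is folded (`mark_ray`); nothing is folded
at nearby points in the interiors of the sectors (`mark_sector`). -/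
structure Scaffolding {Z : Type*} [TopologicalSpace Z] (X : Construction Z) where
  mark : ∀ z, ZMod (X.sectors z) → EdgeMark
  mark_ray : ∀ z i, ∀ᶠ t in 𝓝[>] (0 : ℝ), ∀ k,
    (∀ᶠ s in 𝓝[>] (0 : ℝ), X.ray (X.ray z i t) k s = X.ray z i (t + s)) →
      mark (X.ray z i t) k = mark z i ∧
      mark (X.ray z i t) (k + 3) = (mark z i).reverse ∧
      ∀ l, l ≠ k → l ≠ k + 3 → mark (X.ray z i t) l = EdgeMark.unfolded
  mark_sector : ∀ z i, ∀ᶠ w in 𝓝 z,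
    0 < (X.chart z w).1 i → 0 < (X.chart z w).1 (i + 1) → ∀ k, mark w k = EdgeMark.unfolded

namespace Scaffolding

variable {Z : Type*} [TopologicalSpace Z] {X : Construction Z} (S : Scaffolding X)

/-- There are `n` sectors at `z`, the germs in `I` are the inward fold edges, those in `O`
are the outward fold edges, and all others are unfolded. -/
def HasPicture (z : Z) (n : ℕ) (I O : Set (ZMod (X.sectors z))) : Prop :=
  X.sectors z = n ∧
    ∀ k, (S.mark z k = EdgeMark.inward ↔ k ∈ I) ∧ (S.mark z k = EdgeMark.outward ↔ k ∈ O)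

/-- Type `6₀`: a flat point not on the scaffolding. -/
def Is60 (z : Z) : Prop := S.HasPicture z 6 ∅ ∅

/-- Type `6₂`: an interior point of a straight fold edge. -/
def Is62 (z : Z) : Prop := ∃ a, S.HasPicture z 6 {a} {a + 3}

/-- Type `6₃`: three fold edges at `120°`, two inward and one outward. -/
def Is63 (z : Z) : Prop := ∃ a, S.HasPicture z 6 {a, a + 2} {a + 4}

/-- Type `6₄`: a straight oriented line of two fold edges (the spine, from `a` to `a + 3`), and two
more fold edges, one inward and one outward, at `60°` on either side of the outward
half `a + 3` of the spine. -/
def Is64 (z : Z) : Prop :=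
  ∃ a s, (s = 1 ∨ s = -1) ∧ S.HasPicture z 6 {a, a + 2 * s} {a + 3, a - 2 * s}

/-- Type `8₀`. -/
def Is80 (z : Z) : Prop := S.HasPicture z 8 ∅ ∅

/-- Type `8₁`. -/
def Is81 (z : Z) : Prop := ∃ a, S.HasPicture z 8 ∅ {a}

/-- Type `8₂`: two outward fold edges, separated by four sectors. -/
def Is82 (z : Z) : Prop := ∃ a, S.HasPicture z 8 ∅ {a, a + 4}

/-- Type `8'₂`: two outward fold edges, separated by one sector. -/
def Is82' (z : Z) : Prop := ∃ a, S.HasPicture z 8 ∅ {a, a + 1}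

/-- Type `4₂`: two opposite inward fold edges. -/
def Is42 (z : Z) : Prop := ∃ a, S.HasPicture z 4 {a, a + 2} ∅

/-- The singularities of the scaffolding are standard. -/
def IsStandard : Prop :=
  ∀ z, S.Is60 z ∨ S.Is62 z ∨ S.Is63 z ∨ S.Is64 z ∨
    S.Is80 z ∨ S.Is81 z ∨ S.Is82 z ∨ S.Is82' z ∨ S.Is42 z

/-- Singularities: all points except the flat points off the scaffolding and the interior
points of fold edges.  The `8₀` points are included. -/
def IsSingular (z : Z) : Prop := ¬ S.Is60 z ∧ ¬ S.Is62 z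

/-- The possible configurations of a spectral network graph for the (fully) refracting spectral
network at a node `z`, given by the set of directions of the edges of the graph issuing from it:
* an end of the graph at a singularity, in any non-fold direction;
* a collision of three lines at `120°`, at a point not on a fold edge;
* a crossing of a fold edge, where the line may come from either of the two directions on one side
  of the fold edge and go out in either of the two directions on the other side;
* a straight passage through a point not on a fold edge (a mere subdivision of an edge). -/
inductive NodeStar (z : Z) : Set (ZMod (X.sectors z)) → Prop
  | endpoint (k) : S.IsSingular z → S.mark z k = EdgeMark.unfolded → NodeStar z {k}
  | collision (k) : S.Is60 z → NodeStar z {k, k + 2, k + 4}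
  | crossing (f k l) : S.Is62 z → S.mark z f ≠ EdgeMark.unfolded →
      (k = f + 1 ∨ k = f + 2) → (l = f - 1 ∨ l = f - 2) → NodeStar z {k, l}
  | straight (k) : S.Is60 z → NodeStar z {k, k + 3}

/-- A BPS state: a compact spectral network graph for the refracting spectral network, mapped to
the construction.  It is given by a finite nonempty set `V` of nodes, the positions of
the nodes, the set of directions of the half-edges at each node, and the involution `mate`
exchanging the two halves of each edge; each edge goes to a straight segment whose interior points
are flat points not on fold edges. -/
structure BPSState where
  V : Type
  finite : Finite V
  nonempty : Nonempty V
  pos : V → Z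
  star : ∀ v, Set (ZMod (X.sectors (pos v)))
  nodeStar : ∀ v, S.NodeStar (pos v) (star v)
  mate : (Σ v, star v) → (Σ v, star v)
  mate_mate : ∀ h, mate (mate h) = h
  mate_ne : ∀ h, mate h ≠ h
  segment : ∀ h : Σ v, star v,
    X.Segment (fun z _ => S.Is60 z) (pos h.1) h.2 (pos (mate h).1) (mate h).2

/-- A fold edge, oriented from the singularity `p` to the singularity `q`: it leaves `p` along `i`,
arrives at `q` along `j`, and its interior points are of type `6₂` with compatible orientations. -/
def FoldEdge (p : Z) (i : ZMod (X.sectors p)) (q : Z) (j : ZMod (X.sectors q)) : Prop :=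
  S.mark p i = EdgeMark.outward ∧ S.mark q j = EdgeMark.inward ∧
    X.Segment (fun z k => S.Is62 z ∧ S.mark z k = EdgeMark.outward) p i q j

/-- The vertices of the directed graph: one for each singularity not of type `6₄`, and
two for each `6₄` point. -/
inductive Vertex
  | point (z : Z) (h : S.IsSingular z) (h' : ¬ S.Is64 z)
  | spine (z : Z) (h : S.Is64 z)
  | branch (z : Z) (h : S.Is64 z)

variable {S}

/-- The singularity underlying a vertex. -/
def Vertex.pos : S.Vertex → Z
  | point z _ _ => z
  | spine z _ => z
  | branch z _ => z

/-- Which of the fold edges at the singularity are attached to the vertex: all of them, except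
that at a `6₄` point the two opposite fold edges are attached to the vertex `spine` and the two
others to the vertex `branch`. -/
def Vertex.Carries : (v : S.Vertex) → ZMod (X.sectors v.pos) → Prop
  | point _ _ _ => fun _ => True
  | spine z _ => fun k : ZMod (X.sectors z) => S.mark z (k + 3) ≠ EdgeMark.unfolded
  | branch z _ => fun k : ZMod (X.sectors z) => S.mark z (k + 3) = EdgeMark.unfolded

variable (S)

/-- The directed graph of singularities and oriented fold edges. -/
def foldGraph : Digraph S.Vertex where
  Adj v w := ∃ i j, v.Carries i ∧ w.Carries j ∧ S.FoldEdge v.pos i w.pos j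

end Scaffolding

end SpectralNetwork

end

noncomputable section

namespace SpectralNetwork

/-! A directed loop of fold edges would be shadowed by a closed path of the spectral network, and
such a path is part of a BPS state. A vertex on a loop has an inward and an outward fold edge, so it
is a flat point: the standard pictures with eight sectors have no inward edge, and the one with four
sectors has no outward edge.

Along a straight edge with flat ends there is, on either side and for every small `h`, a network
path parallel to the edge, running between the points at distance `h` on the neighbouring germs at
the two ends (`edgeStrip_of_straight`). At a vertex the path has to pass from the inward to the
outward edge (`eventually_passage`). If the two edges are opposite, it goes straight on. If they
form an angle of 120°, the inner path meets only the bisecting germ and turns there, by refraction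
if that germ is folded, and otherwise by a collision whose third leg runs into the singularity. The
outer path goes round the hexagon of radius `h` and needs to bend only at the germ making 120° with
both edges, which must therefore be folded. `Vertex.follows` checks that the standard pictures
provide one of these situations; this is where each 6₄ point must be split into spine and branch.

A loop has finitely many edges, so one `h` serves all of them. Following the paths is a self-map of
the finite set of pairs (edge, side), so some path closes up, though possibly not after one turn
round the loop. The closed path is made into a graph with one node per turn and one endpoint per
collision (`nonempty_bpsState_of_cycle`). The nodes are abstract, so it does not matter if the path
meets itself. -/

/-! ### Linear changes of hexagonal coordinates. -/

/-- The six unit vectors in the directions of walls, indexed cyclically. -/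
def hexVec : ZMod 6 → ℝ × ℝ :=
  ![(1, 0), (0, 1), (-1, 1), (-1, 0), (0, -1), (1, -1)]

/-- Rotation of the plane by `60°`. -/
def hexRot : (ℝ × ℝ) ≃ₗ[ℝ] (ℝ × ℝ) where
  toFun p := (-p.2, p.1 + p.2)
  invFun p := (p.1 + p.2, -p.1)
  map_add' p q := by ext <;> (simp; try ring)
  map_smul' c p := by ext <;> (simp; try ring)
  left_inv p := by ext <;> simp
  right_inv p := by ext <;> simp

/-- Reflection of the plane fixing the zeroth wall direction. -/
def hexRefl : (ℝ × ℝ) ≃ₗ[ℝ] (ℝ × ℝ) where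
  toFun p := (p.1 + p.2, -p.2)
  invFun p := (p.1 + p.2, -p.2)
  map_add' p q := by ext <;> (simp; try ring)
  map_smul' c p := by ext <;> (simp; try ring)
  left_inv p := by ext <;> simp
  right_inv p := by ext <;> simp

/-- The sign `σ` as an element of `ZMod m`. -/
abbrev sgn (m : ℕ) (σ : ℤˣ) : ZMod m := ((σ : ℤ) : ZMod m)

lemma sgn_one (m : ℕ) : sgn m 1 = 1 := by simp [sgn]

lemma sgn_neg_one (m : ℕ) : sgn m (-1) = -1 := by simp [sgn]

lemma sgn_neg (m : ℕ) (σ : ℤˣ) : sgn m (-σ) = -sgn m σ := by simp [sgn]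

lemma sgn_mul (m : ℕ) (σ τ : ℤˣ) : sgn m (σ * τ) = sgn m σ * sgn m τ := by simp [sgn]

lemma exists_sgn_eq {m : ℕ} {s : ZMod m} (h : s = 1 ∨ s = -1) : ∃ σ : ℤˣ, s = sgn m σ := by
  rcases h with rfl | rfl
  · exact ⟨1, (sgn_one m).symm⟩
  · exact ⟨-1, (sgn_neg_one m).symm⟩

lemma sgn_mul_self (m : ℕ) (σ : ℤˣ) : sgn m σ * sgn m σ = 1 := by
  rcases Int.units_eq_one_or σ with rfl | rfl <;> simp [sgn]

lemma hexRot_hexCoord {m : ℕ} (hm : m = 6) (a : ZMod m) (σ : ℤˣ) (y : Cone m) :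
    hexRot (Cone.hexCoord a (sgn m σ) y) = Cone.hexCoord (a - sgn m σ) (sgn m σ) y := by
  subst hm
  generalize sgn 6 σ = s
  have h6 : (6 : ZMod 6) = 0 := rfl
  have e0 : a - s = a + 5 * s := by linear_combination (-s) * h6
  have e1 : a + 5 * s + s = a := by linear_combination s * h6
  have e2 : a + 5 * s + 2 * s = a + s := by linear_combination s * h6
  have e3 : a + 5 * s + 3 * s = a + 2 * s := by linear_combination s * h6
  have e4 : a + 5 * s + 4 * s = a + 3 * s := by linear_combination s * h6
  have e5 : a + 5 * s + 5 * s = a + 4 * s := by linear_combination s * h6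
  simp only [Cone.hexCoord, e0, e1, e2, e3, e4, e5, hexRot, LinearEquiv.coe_mk, LinearMap.coe_mk,
    AddHom.coe_mk]
  ext <;> simp only <;> ring

lemma hexRefl_hexCoord {m : ℕ} (hm : m = 6) (a : ZMod m) (σ : ℤˣ) (y : Cone m) :
    hexRefl (Cone.hexCoord a (sgn m σ) y) = Cone.hexCoord a (sgn m (-σ)) y := by
  subst hm
  rw [sgn_neg]
  generalize sgn 6 σ = s
  have h6 : (6 : ZMod 6) = 0 := rfl
  have e1 : a + -s = a + 5 * s := by linear_combination (-s) * h6
  have e2 : a + 2 * -s = a + 4 * s := by linear_combination (-s) * h6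
  have e3 : a + 3 * -s = a + 3 * s := by linear_combination (-s) * h6
  have e4 : a + 4 * -s = a + 2 * s := by linear_combination (-s) * h6
  have e5 : a + 5 * -s = a + s := by linear_combination (-s) * h6
  simp only [Cone.hexCoord, e1, e2, e3, e4, e5, hexRefl, LinearEquiv.coe_mk, LinearMap.coe_mk,
    AddHom.coe_mk]
  ext <;> simp only <;> ring

/-- The map `T` is chosen before `m`, because a single `T` must act on the cones at two different
points. The form `m = 6` is needed since the number of sectors at a point equals 6 only
propositionally. -/
lemma exists_rot_iterate (n : ℕ) : ∃ T : (ℝ × ℝ) ≃ₗ[ℝ] (ℝ × ℝ),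
    ∀ {m : ℕ}, m = 6 → ∀ (a : ZMod m) (σ : ℤˣ) (y : Cone m),
      T (Cone.hexCoord a (sgn m σ) y) = Cone.hexCoord (a - (n : ZMod m) * sgn m σ) (sgn m σ) y := by
  induction n with
  | zero => exact ⟨LinearEquiv.refl ℝ _, fun _ _ _ _ => by simp⟩
  | succ n ih =>
    obtain ⟨T, hT⟩ := ih
    refine ⟨T.trans hexRot, fun hm a σ y => ?_⟩
    rw [LinearEquiv.trans_apply, hT hm, hexRot_hexCoord hm]
    congr 1
    push_cast
    ring

/-- Change of hexagonal coordinates: the edge `a + l σ` of one frame is the zeroth edge of the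
other. -/
lemma exists_hexCoord_change (l : ℤ) (σ : ℤˣ) : ∃ T : (ℝ × ℝ) ≃ₗ[ℝ] (ℝ × ℝ),
    ∀ {m : ℕ}, m = 6 → ∀ (a : ZMod m) (ρ : ℤˣ) (y : Cone m),
      T (Cone.hexCoord a (sgn m ρ) y) =
        Cone.hexCoord (a - (l : ZMod m) * sgn m (σ * ρ)) (sgn m (σ * ρ)) y := by
  obtain ⟨T, hT⟩ := exists_rot_iterate (l : ZMod 6).val
  have hl : ∀ {m : ℕ}, m = 6 → (((l : ZMod 6).val : ℕ) : ZMod m) = (l : ZMod m) := by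
    rintro m rfl
    exact ZMod.natCast_zmod_val _
  rcases Int.units_eq_one_or σ with rfl | rfl
  · exact ⟨T, fun hm a ρ y => by rw [hT hm, hl hm, one_mul]⟩
  · refine ⟨hexRefl.trans T, fun hm a ρ y => ?_⟩
    rw [LinearEquiv.trans_apply, hexRefl_hexCoord hm, hT hm, hl hm, neg_one_mul]

/-- The second clause lets a transition formula at a nearby point survive the change of frame at the
centre: `T` turns its linear part into hexagonal coordinates of another frame. -/
lemma exists_hexCoord_change' {m : ℕ} (hm : m = 6) (a b : ZMod m) (σ ρ : ℤˣ) :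
    ∃ T : (ℝ × ℝ) ≃ₗ[ℝ] (ℝ × ℝ),
    (∀ y : Cone m, T (Cone.hexCoord a (sgn m ρ) y) = Cone.hexCoord b (sgn m σ) y) ∧
    ∀ {n : ℕ}, n = 6 → ∀ c : ZMod n, ∀ τ : ℤˣ, ∃ c' : ZMod n, ∃ τ' : ℤˣ, ∀ y : Cone n,
      T (Cone.hexCoord c (sgn n τ) y) = Cone.hexCoord c' (sgn n τ') y := by
  obtain ⟨l, hl⟩ := ZMod.intCast_surjective ((a - b) * sgn m σ)
  obtain ⟨T, hT⟩ := exists_hexCoord_change l (σ * ρ)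
  refine ⟨T, fun y => ?_, fun hn c τ => ⟨_, _, fun y => hT hn c τ y⟩⟩
  have h1 : σ * ρ * ρ = σ := by rw [mul_assoc, Int.units_mul_self, mul_one]
  rw [hT hm, hl, h1, mul_assoc, sgn_mul_self]
  congr 1
  ring

lemma hexCoord_apex {m : ℕ} (a s : ZMod m) : Cone.hexCoord a s (Cone.apex m) = 0 := by
  simp [Cone.hexCoord, Cone.apex]

lemma zmod_six_cases (x : ZMod 6) : x = 0 ∨ x = 1 ∨ x = 2 ∨ x = 3 ∨ x = 4 ∨ x = 5 := by
  revert x; decide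

lemma hexVec_zero : hexVec 0 = (1, 0) := rfl
lemma hexVec_one : hexVec 1 = (0, 1) := rfl
lemma hexVec_two : hexVec 2 = (-1, 1) := rfl
lemma hexVec_three : hexVec 3 = (-1, 0) := rfl
lemma hexVec_four : hexVec 4 = (0, -1) := rfl
lemma hexVec_five : hexVec 5 = (1, -1) := rfl

lemma hexVec_injective : Function.Injective hexVec := by
  intro x y h
  rcases zmod_six_cases x with rfl | rfl | rfl | rfl | rfl | rfl <;>
  rcases zmod_six_cases y with rfl | rfl | rfl | rfl | rfl | rfl <;>
  first
  | rfl
  | (simp only [hexVec_zero, hexVec_one, hexVec_two, hexVec_three, hexVec_four, hexVec_five,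
      Prod.mk.injEq] at h
     norm_num at h)

lemma hexVec_add_three (x : ZMod 6) : hexVec (x + 3) = -hexVec x := by
  rcases zmod_six_cases x with rfl | rfl | rfl | rfl | rfl | rfl
  · change hexVec 3 = _; simp [hexVec_zero, hexVec_three]
  · change hexVec 4 = _; simp [hexVec_one, hexVec_four]
  · change hexVec 5 = _; simp [hexVec_two, hexVec_five]
  · change hexVec 0 = _; simp [hexVec_zero, hexVec_three]
  · change hexVec 1 = _; simp [hexVec_one, hexVec_four]
  · change hexVec 2 = _; simp [hexVec_two, hexVec_five]

lemma hexCoord_ray {m : ℕ} (hm : m = 6) (a : ZMod m) (σ : ℤˣ) (l : ℤ) {t : ℝ} (ht : 0 ≤ t) :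
    Cone.hexCoord a (sgn m σ) (Cone.ray (a + (l : ZMod m) * sgn m σ) t) = t • hexVec l := by
  subst hm
  generalize (l : ZMod 6) = x
  rcases Int.units_eq_one_or σ with rfl | rfl <;>
  simp only [sgn_one, sgn_neg_one, Cone.hexCoord, Cone.ray, max_eq_left ht, Pi.single_apply,
      add_right_inj, left_eq_add] <;>
  rcases zmod_six_cases x with rfl | rfl | rfl | rfl | rfl | rfl <;>
  simp +decide [hexVec_zero, hexVec_one, hexVec_two, hexVec_three, hexVec_four, hexVec_five]

/-- A point with positive `k`-th coordinate is supported on `k - 1`, `k`, `k + 1`, so the other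
terms of the global formula vanish. -/
lemma hexCoord_star {m : ℕ} (hm : m = 6) (k : ZMod m) (y : Cone m) (hy : 0 < y.1 k) :
    Cone.starCoord k y = Cone.hexCoord k (sgn m 1) y := by
  subst hm
  obtain ⟨i, hi⟩ := y.2.2
  have hk := hi _ hy.ne'
  have h0 : ∀ j, ¬ (j = i ∨ j = i + 1) → y.1 j = 0 := fun j hj => by
    by_contra h; exact hj (hi j h)
  have h2 : y.1 (k + 2) = 0 := h0 _ (by clear hi h0 hy; revert i k; decide)
  have h3 : y.1 (k + 3) = 0 := h0 _ (by clear hi h0 hy h2; revert i k; decide)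
  have h4 : y.1 (k + 4) = 0 := h0 _ (by clear hi h0 hy h2 h3; revert i k; decide)
  have h5 : k - 1 = k + 5 := by rw [sub_eq_add_neg]; rfl
  simp [Cone.starCoord, Cone.hexCoord, h2, h3, h4, h5, sgn_one]

/-! ### The six-sector cone as a plane. -/

/-- The coordinates on the hexagonal cone, in terms of the plane coordinates. -/
def hexCoeff (p : ℝ × ℝ) : ZMod 6 → ℝ :=
  ![max 0 (min p.1 (p.1 + p.2)), max 0 (min p.2 (p.1 + p.2)), max 0 (min (-p.1) p.2),
    max 0 (min (-p.1) (-p.1 - p.2)), max 0 (min (-p.2) (-p.1 - p.2)), max 0 (min p.1 (-p.2))]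

lemma hexCoeff_zero (p : ℝ × ℝ) : hexCoeff p 0 = max 0 (min p.1 (p.1 + p.2)) := rfl
lemma hexCoeff_one (p : ℝ × ℝ) : hexCoeff p 1 = max 0 (min p.2 (p.1 + p.2)) := rfl
lemma hexCoeff_two (p : ℝ × ℝ) : hexCoeff p 2 = max 0 (min (-p.1) p.2) := rfl
lemma hexCoeff_three (p : ℝ × ℝ) : hexCoeff p 3 = max 0 (min (-p.1) (-p.1 - p.2)) := rfl
lemma hexCoeff_four (p : ℝ × ℝ) : hexCoeff p 4 = max 0 (min (-p.2) (-p.1 - p.2)) := rfl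
lemma hexCoeff_five (p : ℝ × ℝ) : hexCoeff p 5 = max 0 (min p.1 (-p.2)) := rfl

/-- The signs of `p.1`, `p.2` and `p.1 + p.2` determine the sector containing `p`. -/
lemma hexCoeff_support (p : ℝ × ℝ) : ∃ i, ∀ j, hexCoeff p j ≠ 0 → j = i ∨ j = i + 1 := by
  have key : ∀ i : ZMod 6, hexCoeff p (i + 2) = 0 → hexCoeff p (i + 3) = 0 →
      hexCoeff p (i + 4) = 0 → hexCoeff p (i + 5) = 0 →
      ∃ i, ∀ j, hexCoeff p j ≠ 0 → j = i ∨ j = i + 1 := by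
    intro i h2 h3 h4 h5
    refine ⟨i, fun j hj => ?_⟩
    by_contra hc
    have : j = i + 2 ∨ j = i + 3 ∨ j = i + 4 ∨ j = i + 5 := by
      clear h2 h3 h4 h5 hj
      revert i j; decide
    rcases this with rfl | rfl | rfl | rfl <;> contradiction
  rcases le_total 0 p.1 with h1 | h1 <;> rcases le_total 0 p.2 with h2 | h2 <;>
    rcases le_total 0 (p.1 + p.2) with h3 | h3
  · apply key 0 <;> apply max_eq_left <;> grind
  · apply key 0 <;> apply max_eq_left <;> grind
  · apply key 5 <;> apply max_eq_left <;> grind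
  · apply key 4 <;> apply max_eq_left <;> grind
  · apply key 1 <;> apply max_eq_left <;> grind
  · apply key 2 <;> apply max_eq_left <;> grind
  · apply key 3 <;> apply max_eq_left <;> grind
  · apply key 3 <;> apply max_eq_left <;> grind

lemma hexCoord_zero_one (y : Cone 6) : Cone.hexCoord 0 (sgn 6 1) y =
    (y.1 0 - y.1 2 - y.1 3 + y.1 5, y.1 1 + y.1 2 - y.1 4 - y.1 5) := by
  simp [Cone.hexCoord, sgn_one]

lemma cone_cases (y : Cone 6) :
    (y.1 2 = 0 ∧ y.1 3 = 0 ∧ y.1 4 = 0 ∧ y.1 5 = 0) ∨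
    (y.1 3 = 0 ∧ y.1 4 = 0 ∧ y.1 5 = 0 ∧ y.1 0 = 0) ∨
    (y.1 4 = 0 ∧ y.1 5 = 0 ∧ y.1 0 = 0 ∧ y.1 1 = 0) ∨
    (y.1 5 = 0 ∧ y.1 0 = 0 ∧ y.1 1 = 0 ∧ y.1 2 = 0) ∨
    (y.1 0 = 0 ∧ y.1 1 = 0 ∧ y.1 2 = 0 ∧ y.1 3 = 0) ∨
    (y.1 1 = 0 ∧ y.1 2 = 0 ∧ y.1 3 = 0 ∧ y.1 4 = 0) := by
  obtain ⟨i, hi⟩ := y.2.2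
  have h : ∀ j, ¬ (j = i ∨ j = i + 1) → y.1 j = 0 := fun j hj => by
    by_contra h; exact hj (hi j h)
  rcases zmod_six_cases i with rfl | rfl | rfl | rfl | rfl | rfl
  · exact Or.inl ⟨h _ (by decide), h _ (by decide), h _ (by decide), h _ (by decide)⟩
  · exact Or.inr (Or.inl ⟨h _ (by decide), h _ (by decide), h _ (by decide), h _ (by decide)⟩)
  · exact Or.inr (Or.inr (Or.inl
      ⟨h _ (by decide), h _ (by decide), h _ (by decide), h _ (by decide)⟩))
  · exact Or.inr (Or.inr (Or.inr (Or.inl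
      ⟨h _ (by decide), h _ (by decide), h _ (by decide), h _ (by decide)⟩)))
  · exact Or.inr (Or.inr (Or.inr (Or.inr (Or.inl
      ⟨h _ (by decide), h _ (by decide), h _ (by decide), h _ (by decide)⟩))))
  · exact Or.inr (Or.inr (Or.inr (Or.inr (Or.inr
      ⟨h _ (by decide), h _ (by decide), h _ (by decide), h _ (by decide)⟩))))

lemma hexCoeff_hexCoord (y : Cone 6) : hexCoeff (Cone.hexCoord 0 (sgn 6 1) y) = y.1 := by
  rw [hexCoord_zero_one]
  have p0 := y.2.1 0
  have p1 := y.2.1 1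
  have p2 := y.2.1 2
  have p3 := y.2.1 3
  have p4 := y.2.1 4
  have p5 := y.2.1 5
  funext j
  rcases cone_cases y with h | h | h | h | h | h <;>
  obtain ⟨h1, h2, h3, h4⟩ := h <;>
  simp only [h1, h2, h3, h4] <;>
  rcases zmod_six_cases j with rfl | rfl | rfl | rfl | rfl | rfl <;>
  simp only [hexCoeff_zero, hexCoeff_one, hexCoeff_two, hexCoeff_three, hexCoeff_four,
    hexCoeff_five, h1, h2, h3, h4] <;>
  grind

lemma hexCoord_hexCoeff (p : ℝ × ℝ) :
    Cone.hexCoord 0 (sgn 6 1) ⟨hexCoeff p, fun j => by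
      rcases zmod_six_cases j with rfl | rfl | rfl | rfl | rfl | rfl <;>
      exact le_max_left _ _, hexCoeff_support p⟩ = p := by
  rw [hexCoord_zero_one]
  simp only [hexCoeff_zero, hexCoeff_one, hexCoeff_two, hexCoeff_three, hexCoeff_four,
    hexCoeff_five]
  ext
  · simp only
    grind
  · simp only
    grind

/-- The cone with six sectors is the plane. -/
def hexHomeomorphBase : Cone 6 ≃ₜ ℝ × ℝ where
  toFun := Cone.hexCoord 0 (sgn 6 1)
  invFun p := ⟨hexCoeff p, fun j => by
      rcases zmod_six_cases j with rfl | rfl | rfl | rfl | rfl | rfl <;>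
      exact le_max_left _ _, hexCoeff_support p⟩
  left_inv y := Subtype.ext (hexCoeff_hexCoord y)
  right_inv p := hexCoord_hexCoeff p
  continuous_toFun := by
    have hj : ∀ j, Continuous fun y : Cone 6 => y.1 j :=
      fun j => (continuous_apply j).comp continuous_subtype_val
    exact ((((hj _).sub (hj _)).sub (hj _)).add (hj _)).prodMk
      ((((hj _).add (hj _)).sub (hj _)).sub (hj _))
  continuous_invFun := by
    refine Continuous.subtype_mk (continuous_pi fun j => ?_) _
    rcases zmod_six_cases j with rfl | rfl | rfl | rfl | rfl | rfl <;>
    simp only [hexCoeff_zero, hexCoeff_one, hexCoeff_two, hexCoeff_three, hexCoeff_four,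
      hexCoeff_five] <;>
    fun_prop

lemma exists_hexHomeomorph {m : ℕ} (hm : m = 6) (a : ZMod m) (σ : ℤˣ) :
    ∃ H : Cone m ≃ₜ ℝ × ℝ, ∀ y, H y = Cone.hexCoord a (sgn m σ) y := by
  subst hm
  obtain ⟨T, hT, -⟩ := exists_hexCoord_change' rfl (0 : ZMod 6) a σ 1
  exact ⟨hexHomeomorphBase.trans T.toContinuousLinearEquiv.toHomeomorph, fun y => hT y⟩

/-- This identifies the open positive quadrant of the coordinates with an open sector, where
`mark_sector` excludes folds. -/
lemma hexCoord_pos {m : ℕ} (hm : m = 6) (a : ZMod m) (σ : ℤˣ) (y : Cone m)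
    (h1 : 0 < (Cone.hexCoord a (sgn m σ) y).1) (h2 : 0 < (Cone.hexCoord a (sgn m σ) y).2) :
    0 < y.1 a ∧ 0 < y.1 (a + sgn m σ) := by
  subst hm
  have hsupp : ∃ i, ∀ j, y.1 (a + j * sgn 6 σ) ≠ 0 → j = i ∨ j = i + 1 := by
    obtain ⟨i, hi⟩ := y.2.2
    rcases Int.units_eq_one_or σ with rfl | rfl
    · refine ⟨i - a, fun j hj => ?_⟩
      have h := hi _ hj
      rw [sgn_one] at h
      clear hi hj h1 h2
      revert i j a; decide
    · refine ⟨a - i - 1, fun j hj => ?_⟩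
      have h := hi _ hj
      rw [sgn_neg_one] at h
      clear hi hj h1 h2
      revert i j a; decide
  have hc := cone_cases ⟨fun l => y.1 (a + l * sgn 6 σ), fun l => y.2.1 _, hsupp⟩
  have p : ∀ l : ZMod 6, 0 ≤ y.1 (a + l * sgn 6 σ) := fun l => y.2.1 _
  have p0 := p 0
  have p1 := p 1
  have p2 := p 2
  have p3 := p 3
  have p4 := p 4
  have p5 := p 5
  simp only [Cone.hexCoord] at h1 h2
  simp only [zero_mul, add_zero, one_mul] at hc p0 p1
  rcases hc with h | h | h | h | h | h <;> obtain ⟨e1, e2, e3, e4⟩ := h <;>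
  constructor <;> linarith

/-! ### Directions counted in a frame. -/

/-- The `l`-th direction of the frame `(a, σ)`. -/
def frameDir {m : ℕ} (a : ZMod m) (σ : ℤˣ) (l : ℤ) : ZMod m := a + (l : ZMod m) * sgn m σ

lemma frameDir_zero {m : ℕ} (a : ZMod m) (σ : ℤˣ) : frameDir a σ 0 = a := by simp [frameDir]

lemma sgn_mul_three {m : ℕ} (hm : m = 6) (σ : ℤˣ) : 3 * sgn m σ = 3 := by
  subst hm
  rcases Int.units_eq_one_or σ with rfl | rfl <;> simp only [sgn_one, sgn_neg_one] <;> rfl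

lemma frameDir_add_three {m : ℕ} (hm : m = 6) (a : ZMod m) (σ : ℤˣ) (l : ℤ) :
    frameDir a σ (l + 3) = frameDir a σ l + 3 := by
  have h := sgn_mul_three hm σ
  simp only [frameDir]
  push_cast
  linear_combination h

lemma frameDir_congr {m : ℕ} (hm : m = 6) (a : ZMod m) (σ : ℤˣ) {l l' : ℤ}
    (h : (l : ZMod 6) = (l' : ZMod 6)) : frameDir a σ l = frameDir a σ l' := by
  subst hm
  rw [frameDir, h, frameDir]

lemma exists_frameDir_eq {m : ℕ} (a g : ZMod m) (σ : ℤˣ) : ∃ l, g = frameDir a σ l := by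
  obtain ⟨l, hl⟩ := ZMod.intCast_surjective ((g - a) * sgn m σ)
  refine ⟨l, ?_⟩
  rw [frameDir, hl, mul_assoc, sgn_mul_self]
  ring

lemma frameDir_injective {m : ℕ} (hm : m = 6) (a : ZMod m) (σ : ℤˣ) {l l' : ℤ}
    (h : frameDir a σ l = frameDir a σ l') : (l : ZMod 6) = (l' : ZMod 6) := by
  subst hm
  have h1 := add_left_cancel h
  have h2 := congrArg (· * sgn 6 σ) h1
  simpa only [mul_assoc, sgn_mul_self, mul_one] using h2

lemma frameDir_neg {m : ℕ} (a : ZMod m) (σ : ℤˣ) (l : ℤ) :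
    frameDir a σ (-l) = a - (l : ZMod m) * sgn m σ := by
  simp [frameDir, sub_eq_add_neg]

/-- Directions counted from an edge `l` are recounted from the zeroth one; `ρ` compares the senses
of rotation. -/
lemma frameDir_frameDir {m : ℕ} (a : ZMod m) (σ ρ : ℤˣ) (l n : ℤ) :
    frameDir a σ n = frameDir (frameDir a (ρ * σ) (-l)) (ρ * σ) (l + ρ * n) := by
  have h := sgn_mul_self m ρ
  simp only [frameDir, sgn_mul]
  push_cast
  linear_combination (-(n : ZMod m) * sgn m σ) * h

lemma frameDir_triple {m : ℕ} (hm : m = 6) (a : ZMod m) (τ σ : ℤˣ) :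
    ({frameDir a τ (-σ), frameDir a τ σ, frameDir a τ 3} : Set (ZMod m)) =
      {frameDir a τ 3, frameDir a τ 3 + 2, frameDir a τ 3 + 4} := by
  subst hm
  have h6 : (6 : ZMod 6) = 0 := rfl
  have key : ∀ x : ZMod 6, x = 1 ∨ x = -1 →
      ({a + x, a - x, a + 3} : Set (ZMod 6)) = {a + 3, a + 3 + 2, a + 3 + 4} := by
    rintro x (rfl | rfl)
    · rw [show a + 3 + 2 = a - 1 by linear_combination h6,
        show a + 3 + 4 = a + 1 by linear_combination h6]
      ext y; simp only [Set.mem_insert_iff, Set.mem_singleton_iff]; tauto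
    · rw [show a + 3 + 2 = a + -1 by linear_combination h6,
        show a + 3 + 4 = a - -1 by linear_combination h6]
      ext y; simp only [Set.mem_insert_iff, Set.mem_singleton_iff]; tauto
  have e3 : frameDir a τ 3 = a + 3 := by
    have := sgn_mul_three rfl τ
    simpa [frameDir] using this
  have e1 : frameDir a τ σ = a - (-(sgn 6 σ * sgn 6 τ)) := by
    simp only [frameDir]; ring
  have e2 : frameDir a τ (-σ) = a + -(sgn 6 σ * sgn 6 τ) := by
    simp [frameDir]
  rw [e1, e2, e3]
  apply key
  rcases Int.units_eq_one_or σ with rfl | rfl <;> rcases Int.units_eq_one_or τ with rfl | rfl <;>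
    simp [sgn_one, sgn_neg_one]

lemma hexVec_intCast_add_three (l : ℤ) : hexVec ((l + 3 : ℤ) : ZMod 6) = -hexVec l := by
  rw [← hexVec_add_three]
  norm_num

/-! ### Rays, frames and flat charts. -/

lemma Cone.continuous_ray {m : ℕ} (i : ZMod m) : Continuous (Cone.ray i) := by
  refine Continuous.subtype_mk (continuous_pi fun j => ?_) _
  by_cases h : j = i
  · subst h
    simp only [Pi.single_eq_same]
    fun_prop
  · simp only [Pi.single_eq_of_ne h]
    fun_prop

lemma Cone.ray_zero {m : ℕ} (i : ZMod m) : Cone.ray i 0 = Cone.apex m := by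
  apply Subtype.ext
  simp [Cone.ray, Cone.apex]

lemma exists_cone_pos {m : ℕ} (y : Cone m) (hy : y ≠ Cone.apex m) : ∃ i, 0 < y.1 i := by
  by_contra! h
  exact hy (Subtype.ext (funext fun i => le_antisymm (h i) (y.2.1 i)))

namespace Construction

variable {Z : Type*} [TopologicalSpace Z] (X : Construction Z)

/-- A germ of edge: a point and a germ of edge there. -/
abbrev Germ : Type _ := Σ z, ZMod (X.sectors z)

lemma symm_apex (z : Z) : (X.chart z).symm (Cone.apex _) = z := by
  rw [← X.chart_self z, (X.chart z).left_inv (X.mem_source z)]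

lemma apex_mem_target (z : Z) : Cone.apex _ ∈ (X.chart z).target := by
  rw [← X.chart_self z]
  exact (X.chart z).map_source (X.mem_source z)

lemma ray_zero (z : Z) (i : ZMod (X.sectors z)) : X.ray z i 0 = z := by
  rw [ray, Cone.ray_zero, symm_apex]

lemma tendsto_ray (z : Z) (i : ZMod (X.sectors z)) : Tendsto (X.ray z i) (𝓝 0) (𝓝 z) := by
  have h1 : Tendsto (Cone.ray i) (𝓝 0) (𝓝 (Cone.apex (X.sectors z))) := by
    rw [← Cone.ray_zero i]
    exact (Cone.continuous_ray i).tendsto 0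
  have h2 := ((X.chart z).continuousAt_symm (X.apex_mem_target z)).tendsto
  rw [X.symm_apex] at h2
  exact h2.comp h1

lemma eventually_chart_ray (z : Z) (i : ZMod (X.sectors z)) :
    ∀ᶠ r in 𝓝 (0 : ℝ), X.chart z (X.ray z i r) = Cone.ray i r := by
  have h1 : Tendsto (Cone.ray i) (𝓝 0) (𝓝 (Cone.apex (X.sectors z))) := by
    rw [← Cone.ray_zero i]
    exact (Cone.continuous_ray i).tendsto 0
  filter_upwards [h1.eventually ((X.chart z).open_target.mem_nhds (X.apex_mem_target z))] with r hr
  exact (X.chart z).right_inv hr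

/-- The germs of edges at the flat point `w` are laid out by `f` along the six directions of the
plane, the germ `a` along the zeroth one, and `f` is an isometry near `w`. -/
def Frame (f : Z → ℝ × ℝ) (w : Z) (a : ZMod (X.sectors w)) (σ : ℤˣ) : Prop :=
  X.sectors w = 6 ∧ ∀ᶠ u in 𝓝 w, f u = f w + Cone.hexCoord a (sgn _ σ) (X.chart w u)

/-- A chart with values in the plane that is an isometry preserving the directions of walls. -/
def IsFlatChart (G : OpenPartialHomeomorph Z (ℝ × ℝ)) : Prop :=
  ∀ w ∈ G.source, ∃ a σ, X.Frame G w a σ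

variable {X}

lemma Frame.map_ray {f : Z → ℝ × ℝ} {w : Z} {a : ZMod (X.sectors w)} {σ : ℤˣ}
    (hf : X.Frame f w a σ) (l : ℤ) :
    ∀ᶠ r in 𝓝[≥] (0 : ℝ), f (X.ray w (frameDir a σ l) r) = f w + r • hexVec l := by
  filter_upwards [nhdsWithin_le_nhds ((X.tendsto_ray w (frameDir a σ l)).eventually hf.2),
    nhdsWithin_le_nhds (X.eventually_chart_ray w (frameDir a σ l)), self_mem_nhdsWithin]
    with r h1 h2 h3
  rw [h1, h2, frameDir, hexCoord_ray hf.1 _ _ _ h3]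

lemma Frame.ray_eq {G : OpenPartialHomeomorph Z (ℝ × ℝ)} {w : Z} {a : ZMod (X.sectors w)} {σ : ℤˣ}
    (hf : X.Frame G w a σ) (hw : w ∈ G.source) (l : ℤ) :
    ∀ᶠ r in 𝓝[≥] (0 : ℝ), X.ray w (frameDir a σ l) r = G.symm (G w + r • hexVec l) := by
  filter_upwards [hf.map_ray l, nhdsWithin_le_nhds ((X.tendsto_ray w (frameDir a σ l)).eventually
    (G.open_source.mem_nhds hw))] with r h1 h2
  rw [← h1, G.left_inv h2]

/-- The cone chart composed with the identification of the cone and the plane. At points other than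
`z`, `compatible` supplies an isometry in star coordinates, and these agree with hexagonal ones up
to a linear change. -/
lemma exists_flatChart {z : Z} (hz : X.sectors z = 6) (a : ZMod (X.sectors z)) (σ : ℤˣ) :
    ∃ G : OpenPartialHomeomorph Z (ℝ × ℝ), X.IsFlatChart G ∧ z ∈ G.source ∧ G z = 0 ∧
      X.Frame G z a σ ∧ ∀ u, G u = Cone.hexCoord a (sgn _ σ) (X.chart z u) := by
  obtain ⟨H, hH⟩ := exists_hexHomeomorph hz a σ
  have hG : ∀ u, ((X.chart z).transHomeomorph H) u = Cone.hexCoord a (sgn _ σ) (X.chart z u) :=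
    fun u => hH _
  have hG0 : ((X.chart z).transHomeomorph H) z = 0 := by
    rw [hG, X.chart_self, hexCoord_apex]
  have hFz : X.Frame ((X.chart z).transHomeomorph H) z a σ :=
    ⟨hz, Eventually.of_forall fun u => by rw [hG0, hG, zero_add]⟩
  refine ⟨(X.chart z).transHomeomorph H, fun w hw => ?_, X.mem_source z, hG0, hFz, hG⟩
  have hw : w ∈ (X.chart z).source := hw
  by_cases hap : X.chart z w = Cone.apex _
  · have : w = z := by
      rw [← X.symm_apex z, ← hap, (X.chart z).left_inv hw]
    subst this
    exact ⟨a, σ, hFz⟩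
  obtain ⟨k, hk⟩ := exists_cone_pos _ hap
  obtain ⟨h6, b, s, hs, hev⟩ := X.compatible z w hw k hk
  obtain ⟨τ, rfl⟩ := exists_sgn_eq hs
  obtain ⟨T, hT, hT'⟩ := exists_hexCoord_change' hz k a σ 1
  obtain ⟨c, ρ, hc⟩ := hT' h6 b τ
  refine ⟨c, ρ, h6, ?_⟩
  have hcont : ContinuousAt (fun u => (X.chart z u).1 k) w :=
    ((continuous_apply k).comp continuous_subtype_val).continuousAt.comp
      ((X.chart z).continuousAt hw)
  filter_upwards [hev, hcont.eventually (lt_mem_nhds hk)] with u hu hu'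
  rw [hexCoord_star hz _ _ hu', hexCoord_star hz _ _ hk] at hu
  rw [hG, hG, ← hT, ← hT, hu, map_add, hc]

/-- Used to recognise an abstractly given germ by the plane direction in which its ray moves. -/
lemma Frame.germ_unique {f : Z → ℝ × ℝ} {w : Z} {a : ZMod (X.sectors w)} {σ : ℤˣ}
    (hf : X.Frame f w a σ) (l : ℤ) {g : ZMod (X.sectors w)}
    (hg : ∀ᶠ r in 𝓝[>] (0 : ℝ), f (X.ray w g r) = f w + r • hexVec l) : g = frameDir a σ l := by
  obtain ⟨l', rfl⟩ := exists_frameDir_eq a g σ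
  have h1 := (hf.map_ray l').filter_mono (nhdsWithin_mono _ Set.Ioi_subset_Ici_self)
  obtain ⟨r, hr1, hr2, hr3⟩ := (hg.and (h1.and self_mem_nhdsWithin)).exists
  have hr3 : 0 < r := hr3
  rw [hr1] at hr2
  have h3 := smul_right_injective _ hr3.ne' (add_left_cancel hr2)
  exact frameDir_congr hf.1 _ _ (hexVec_injective h3).symm

lemma ray_injective {w : Z} {g g' : ZMod (X.sectors w)}
    (h : ∀ᶠ r in 𝓝[>] (0 : ℝ), X.ray w g r = X.ray w g' r) : g = g' := by
  obtain ⟨r, hr1, hr2, hr3, hr4⟩ := (h.and (((X.eventually_chart_ray w g).filter_mono nhdsWithin_le_nhds).and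
    (((X.eventually_chart_ray w g').filter_mono nhdsWithin_le_nhds).and self_mem_nhdsWithin))).exists
  have hr4 : 0 < r := hr4
  rw [hr1, hr3] at hr2
  by_contra hne
  have := congrArg (fun y : Cone (X.sectors w) => y.1 g) hr2
  simp [Cone.ray, Pi.single_eq_of_ne hne, hr4.le] at this
  exact hr4.ne this

/-- A plane segment in a wall direction is lifted by `G.symm`. Both end germs point into the
segment, hence the direction `l + 3` at `q`. -/
lemma IsFlatChart.segment {G : OpenPartialHomeomorph Z (ℝ × ℝ)} (hG : X.IsFlatChart G) {p q : Z}
    (hp : p ∈ G.source) (hq : q ∈ G.source) (l : ℤ) {L : ℝ} (hL : 0 < L)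
    (hpq : G q = G p + L • hexVec l) {P : Z → Prop}
    (hP : ∀ t ∈ Set.Ioo 0 L, G p + t • hexVec l ∈ G.target ∧ P (G.symm (G p + t • hexVec l)))
    {a : ZMod (X.sectors p)} {σ : ℤˣ} (ha : X.Frame G p a σ)
    {b : ZMod (X.sectors q)} {τ : ℤˣ} (hb : X.Frame G q b τ) :
    X.Segment (fun z _ => P z) p (frameDir a σ l) q (frameDir b τ (l + 3)) := by
  refine ⟨L, fun t => G.symm (G p + t • hexVec l), hL, ?_, ?_, fun t ht => ?_⟩
  · filter_upwards [ha.ray_eq hp l] with r hr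
    rw [hr]
  · filter_upwards [hb.ray_eq hq (l + 3)] with r hr
    rw [hr, hpq, hexVec_intCast_add_three]
    congr 1
    module
  · have hc := G.map_target (hP t ht).1
    obtain ⟨c, ρ, hf⟩ := hG _ hc
    refine ⟨frameDir c ρ l, ⟨hf.1, ?_⟩, (hP t ht).2⟩
    filter_upwards [hf.ray_eq hc l, hf.ray_eq hc (l + 3)] with r h1 h2
    rw [← frameDir_add_three hf.1, h1, h2, G.right_inv (hP t ht).1, hexVec_intCast_add_three]
    constructor <;> congr 1 <;> module

lemma Segment.symm {P : Z → Prop} {p : Z} {i : ZMod (X.sectors p)} {q : Z}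
    {j : ZMod (X.sectors q)} (h : X.Segment (fun z _ => P z) p i q j) :
    X.Segment (fun z _ => P z) q j p i := by
  obtain ⟨L, c, hL, h1, h2, h3⟩ := h
  refine ⟨L, fun t => c (L - t), hL, h2, ?_, fun t ht => ?_⟩
  · simpa using h1
  · obtain ⟨k, ⟨h6, hk⟩, hP⟩ := h3 (L - t) ⟨by linarith [ht.2], by linarith [ht.1]⟩
    refine ⟨k + 3, ⟨h6, ?_⟩, hP⟩
    filter_upwards [hk] with s hs
    have h33 : k + 3 + 3 = k := by
      have : (6 : ZMod (X.sectors (c (L - t)))) = 0 := by rw [h6]; rfl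
      linear_combination this
    simp only [h33]
    exact ⟨by rw [← hs.2]; congr 1; ring, by rw [← hs.1]; congr 1; ring⟩

/-! ### Nodes on the edges near a flat point. -/

variable (X)

/-- The germ at `w` in the `l`-th direction, in the coordinates `f`. -/
def frameGerm (f : Z → ℝ × ℝ) (w : Z) (l : ℤ) : X.Germ :=
  open Classical in
  if H : ∃ p : ZMod (X.sectors w) × ℤˣ, X.Frame f w p.1 p.2 then
    ⟨w, frameDir H.choose.1 H.choose.2 l⟩
  -- A dummy value: a total function of the distance lets separate lemmas name the same germ and be
  -- glued for all small distances.
  else ⟨w, 0⟩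

/-- The flat coordinates at `z` for which the edge `k` is in direction `0`. -/
def nodeCoord (z : Z) (k : ZMod (X.sectors z)) (u : Z) : ℝ × ℝ :=
  Cone.hexCoord k (sgn _ 1) (X.chart z u)

/-- The germ at the point at distance `h` from `z` on the edge `k`, in the `l`-th direction
counted from the edge `k`. -/
def nodeGerm (z : Z) (k : ZMod (X.sectors z)) (h : ℝ) (l : ℤ) : X.Germ :=
  X.frameGerm (X.nodeCoord z k) (X.ray z k h) l

variable {X}

lemma Frame.frameGerm_eq {f : Z → ℝ × ℝ} {w : Z} {a : ZMod (X.sectors w)} {σ : ℤˣ}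
    (hf : X.Frame f w a σ) :
    ∃ a σ, X.Frame f w a σ ∧ ∀ l, X.frameGerm f w l = ⟨w, frameDir a σ l⟩ := by
  have H : ∃ p : ZMod (X.sectors w) × ℤˣ, X.Frame f w p.1 p.2 := ⟨(a, σ), hf⟩
  refine ⟨H.choose.1, H.choose.2, H.choose_spec, fun l => ?_⟩
  rw [frameGerm, dif_pos H]

lemma tendsto_ray_nhdsGT (z : Z) (k : ZMod (X.sectors z)) :
    Tendsto (X.ray z k) (𝓝[>] 0) (𝓝 z) :=
  (X.tendsto_ray z k).mono_left nhdsWithin_le_nhds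

lemma eventually_node {z : Z} (hz : X.sectors z = 6) (k : ZMod (X.sectors z)) :
    ∀ᶠ h in 𝓝[>] (0 : ℝ), ∃ a σ, X.Frame (X.nodeCoord z k) (X.ray z k h) a σ ∧
      ∀ l, X.nodeGerm z k h l = ⟨X.ray z k h, frameDir a σ l⟩ := by
  obtain ⟨G, hG, hzG, -, -, hGe⟩ := exists_flatChart hz k 1
  filter_upwards [(tendsto_ray_nhdsGT z k).eventually (G.open_source.mem_nhds hzG)] with h hh
  obtain ⟨a, σ, hf⟩ := hG _ hh
  have : ⇑G = X.nodeCoord z k := funext hGe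
  rw [this] at hf
  exact hf.frameGerm_eq

/-- Node germs are defined in coordinates adapted to their own edge; this transfers their frames to
a coordinate system shared by several nodes. -/
lemma Frame.of_node {G : Z → ℝ × ℝ} {w : Z} {A : ZMod (X.sectors w)} {ρ : ℤˣ}
    (hf : X.Frame G w A ρ) (l : ℤ) :
    ∀ᶠ h in 𝓝[>] (0 : ℝ), ∀ a σ,
      X.Frame (X.nodeCoord w (frameDir A ρ l)) (X.ray w (frameDir A ρ l) h) a σ →
      X.Frame G (X.ray w (frameDir A ρ l) h) (frameDir a (ρ * σ) (-l)) (ρ * σ) := by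
  filter_upwards [(tendsto_ray_nhdsGT w (frameDir A ρ l)).eventually hf.2.eventually_nhds]
    with h h3 a σ ha
  obtain ⟨T, hT⟩ := exists_hexCoord_change l ρ
  have hT' : ∀ y, T (Cone.hexCoord a (sgn _ σ) y) =
      Cone.hexCoord (frameDir a (ρ * σ) (-l)) (sgn _ (ρ * σ)) y := fun y => by
    rw [hT ha.1, frameDir_neg]
  refine ⟨ha.1, ?_⟩
  have key : ∀ y, T (Cone.hexCoord (frameDir A ρ l) (sgn _ 1) y) =
      Cone.hexCoord A (sgn _ ρ) y := fun y => by
    rw [hT hf.1, mul_one, frameDir, add_sub_cancel_right]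
  filter_upwards [h3, ha.2] with u hu hu'
  rw [hu, h3.self_of_nhds, ← key, ← key]
  simp only [nodeCoord] at hu'
  rw [hu', map_add, hT', add_assoc]

/-- The nodes on the edges of a flat point `w`, read in a coordinate system around `w`. -/
lemma Frame.eventually_node {G : Z → ℝ × ℝ} {w : Z} {A : ZMod (X.sectors w)} {ρ : ℤˣ}
    (hf : X.Frame G w A ρ) (l : ℤ) :
    ∀ᶠ h in 𝓝[>] (0 : ℝ), G (X.ray w (frameDir A ρ l) h) = G w + h • hexVec l ∧
      ∃ a σ, X.Frame G (X.ray w (frameDir A ρ l) h) a σ ∧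
        ∀ m, X.nodeGerm w (frameDir A ρ l) h m =
          ⟨X.ray w (frameDir A ρ l) h, frameDir a σ (l + ρ * m)⟩ := by
  filter_upwards [Construction.eventually_node hf.1 (frameDir A ρ l),
    nhdsWithin_mono _ Set.Ioi_subset_Ici_self (hf.map_ray l), hf.of_node l] with h h1 h2 h3
  refine ⟨h2, ?_⟩
  obtain ⟨a, σ, ha, hg⟩ := h1
  refine ⟨_, _, h3 a σ ha, fun m => ?_⟩
  rw [hg]
  congr 1
  exact frameDir_frameDir _ _ _ _ _

end Construction

/-- Needed to read off the germ of a ray at one of its own points, forwards and backwards. -/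
lemma eventually_nhdsGT_shift {P : ℝ → Prop} (h : ∀ᶠ t in 𝓝[>] (0 : ℝ), P t) :
    ∀ᶠ t in 𝓝[>] (0 : ℝ), (∀ᶠ r in 𝓝[>] (0 : ℝ), P (t + r)) ∧ ∀ᶠ r in 𝓝[>] (0 : ℝ), P (t - r) := by
  obtain ⟨ε, hε, hP⟩ := mem_nhdsGT_iff_exists_Ioo_subset.1 h
  have hε : 0 < ε := hε
  filter_upwards [Ioo_mem_nhdsGT hε] with t ht
  constructor
  · filter_upwards [Ioo_mem_nhdsGT (show 0 < ε - t by linarith [ht.2])] with r hr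
    exact hP ⟨by linarith [ht.1, hr.1], by linarith [hr.2]⟩
  · filter_upwards [Ioo_mem_nhdsGT ht.1] with r hr
    exact hP ⟨by linarith [ht.1, hr.2], by linarith [ht.2, hr.1]⟩

/-! ### Network paths, and marks near a flat point. -/

namespace Scaffolding

open Construction

variable {Z : Type*} [TopologicalSpace Z] {X : Construction Z} (S : Scaffolding X)

/-- The two germs are the ends of a straight segment with interior points off the scaffolding. -/
def Seg (g g' : X.Germ) : Prop :=
  X.Segment (fun z _ => S.Is60 z) g.1 g.2 g'.1 g'.2

lemma Seg.symm {S : Scaffolding X} {g g' : X.Germ} (h : S.Seg g g') : S.Seg g' g :=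
  Segment.symm h

/-- A path of the spectral network may arrive along one of the germs and leave along the other,
possibly with a third segment ending at a singularity. -/
inductive Turn : X.Germ → X.Germ → Prop
  | pair (w k l) : k ≠ l → S.NodeStar w {k, l} → Turn ⟨w, k⟩ ⟨w, l⟩
  | triple (w k l m) (g : X.Germ) : k ≠ l → k ≠ m → l ≠ m → S.NodeStar w {k, l, m} →
      S.Seg ⟨w, m⟩ g → S.NodeStar g.1 {g.2} → Turn ⟨w, k⟩ ⟨w, l⟩

/-- The two germs are the ends of a path of the spectral network. -/
inductive Walk : X.Germ → X.Germ → Prop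
  | seg {g g'} : S.Seg g g' → Walk g g'
  | trans {g m m' g'} : Walk g m → S.Turn m m' → Walk m' g' → Walk g g'

variable {S}

lemma Turn.symm {g g' : X.Germ} (h : S.Turn g g') : S.Turn g' g := by
  rcases h with ⟨w, k, l, hkl, hn⟩ | ⟨w, k, l, m, g, hkl, hkm, hlm, hn, hs, hg⟩
  · exact Turn.pair w l k hkl.symm (by rwa [Set.pair_comm])
  · exact Turn.triple w l k m g hkl.symm hlm hkm (by rwa [Set.insert_comm]) hs hg

lemma Walk.symm {g g' : X.Germ} (h : S.Walk g g') : S.Walk g' g := by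
  induction h with
  | seg h => exact Walk.seg h.symm
  | trans _ ht _ ih1 ih2 => exact ih2.trans ht.symm ih1

variable (S)

lemma is60_of_unfolded {w : Z} (h6 : X.sectors w = 6)
    (h : ∀ k, S.mark w k = EdgeMark.unfolded) : S.Is60 w :=
  ⟨h6, fun k => by simp [h k]⟩

/-- Choosing the frame `(k, σ)` puts the sector between `k` and `k + σ` in the positive quadrant, so
both sides of an edge are treated alike. -/
lemma exists_sector_chart {z : Z} (hz : X.sectors z = 6) (k : ZMod (X.sectors z)) (σ : ℤˣ) :
    ∃ G : OpenPartialHomeomorph Z (ℝ × ℝ), X.IsFlatChart G ∧ z ∈ G.source ∧ G z = 0 ∧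
      X.Frame G z k σ ∧ ∃ r > 0, ∀ p : ℝ × ℝ, |p.1| < r → |p.2| < r →
        p ∈ G.target ∧ (0 < p.1 → 0 < p.2 → S.Is60 (G.symm p)) := by
  obtain ⟨G, hG, hzG, h0, hF, hGe⟩ := exists_flatChart hz k σ
  refine ⟨G, hG, hzG, h0, hF, ?_⟩
  have hsec : ∀ᶠ w in 𝓝 z, 0 < (X.chart z w).1 k → 0 < (X.chart z w).1 (k + sgn _ σ) →
      ∀ l, S.mark w l = EdgeMark.unfolded := by
    rcases Int.units_eq_one_or σ with rfl | rfl
    · simpa only [sgn_one] using S.mark_sector z k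
    · filter_upwards [S.mark_sector z (k - 1)] with w hw h1 h2
      rw [sgn_neg_one, ← sub_eq_add_neg] at h2
      rw [sub_add_cancel] at hw
      exact hw h2 h1
  have h0t : (0 : ℝ × ℝ) ∈ G.target := h0 ▸ G.map_source hzG
  have hz0 : G.symm 0 = z := by rw [← h0, G.left_inv hzG]
  have hcont := (G.continuousAt_symm h0t).tendsto
  rw [hz0] at hcont
  obtain ⟨r, hr, hball⟩ := Metric.eventually_nhds_iff.1
    ((hcont.eventually hsec).and (G.open_target.mem_nhds h0t))
  refine ⟨r, hr, fun p h1 h2 => ?_⟩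
  have hd : dist p 0 < r := by
    rw [dist_zero_right, Prod.norm_def]
    exact max_lt h1 h2
  obtain ⟨h3, h4⟩ := hball hd
  refine ⟨h4, fun hp1 hp2 => ?_⟩
  obtain ⟨a, τ, hf⟩ := hG _ (G.map_target h4)
  have hco : Cone.hexCoord k (sgn _ σ) (X.chart z (G.symm p)) = p := by
    rw [← hGe, G.right_inv h4]
  obtain ⟨h5, h6⟩ := hexCoord_pos hz k σ (X.chart z (G.symm p)) (by rwa [hco]) (by rwa [hco])
  exact S.is60_of_unfolded hf.1 (h3 h5 h6)

/-- The marks at a node. -/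
lemma eventually_node_mark {z : Z} (hz : X.sectors z = 6) (k : ZMod (X.sectors z)) :
    ∀ᶠ h in 𝓝[>] (0 : ℝ), ∃ a σ, X.Frame (X.nodeCoord z k) (X.ray z k h) a σ ∧
      (∀ l, X.nodeGerm z k h l = ⟨X.ray z k h, frameDir a σ l⟩) ∧
      S.mark (X.ray z k h) a = S.mark z k ∧
      S.mark (X.ray z k h) (a + 3) = (S.mark z k).reverse ∧
      ∀ l, l ≠ a → l ≠ a + 3 → S.mark (X.ray z k h) l = EdgeMark.unfolded := by
  obtain ⟨G, hG, hzG, h0, hF, hGe⟩ := exists_flatChart hz k 1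
  have hGn : ⇑G = X.nodeCoord z k := funext hGe
  have hray : ∀ᶠ h in 𝓝[>] (0 : ℝ), G (X.ray z k h) = h • hexVec 0 ∧ X.ray z k h ∈ G.source := by
    have := hF.map_ray 0
    rw [frameDir_zero, h0] at this
    filter_upwards [this.filter_mono (nhdsWithin_mono _ Set.Ioi_subset_Ici_self),
      (tendsto_ray_nhdsGT z k).eventually (G.open_source.mem_nhds hzG)] with h h1 h2
    exact ⟨by simpa using h1, h2⟩
  filter_upwards [eventually_node hz k, hray, eventually_nhdsGT_shift hray, S.mark_ray z k]
    with h h1 h2 h3 h4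
  obtain ⟨a, σ, hf, hg⟩ := h1
  refine ⟨a, σ, hf, hg, h4 a ?_⟩
  rw [← hGn] at hf
  have h5 := hf.map_ray 0
  rw [frameDir_zero] at h5
  filter_upwards [h5.filter_mono (nhdsWithin_mono _ Set.Ioi_subset_Ici_self), h3.1,
    (tendsto_ray_nhdsGT (X.ray z k h) a).eventually (G.open_source.mem_nhds h2.2)] with s h6 h7 h8
  apply G.injOn h8 h7.2
  rw [h6, h7.1, h2.1, add_smul]
  simp

lemma eventually_node_is60 {z : Z} (hz : X.sectors z = 6) (k : ZMod (X.sectors z))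
    (hk : S.mark z k = EdgeMark.unfolded) : ∀ᶠ h in 𝓝[>] (0 : ℝ), S.Is60 (X.ray z k h) := by
  filter_upwards [S.eventually_node_mark hz k] with h hh
  obtain ⟨a, σ, hf, -, h1, h2, h3⟩ := hh
  refine S.is60_of_unfolded hf.1 fun l => ?_
  by_cases hl : l = a
  · rw [hl, h1, hk]
  · by_cases hl' : l = a + 3
    · rw [hl', h2, hk, EdgeMark.reverse]
    · exact h3 l hl hl'

lemma is62_of_marks {w : Z} (h6 : X.sectors w = 6) (a : ZMod (X.sectors w)) {μ : EdgeMark}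
    (hμ : μ ≠ EdgeMark.unfolded) (h1 : S.mark w a = μ) (h2 : S.mark w (a + 3) = μ.reverse)
    (h3 : ∀ l, l ≠ a → l ≠ a + 3 → S.mark w l = EdgeMark.unfolded) : S.Is62 w := by
  have h33 : a + 3 + 3 = a := by
    have : (6 : ZMod (X.sectors w)) = 0 := by rw [h6]; rfl
    linear_combination this
  have hne : a + 3 ≠ a := by
    intro h
    have h3 : (3 : ZMod (X.sectors w)) = 0 := by simpa using h
    rw [h6] at h3
    exact absurd h3 (by decide)
  cases μ with
  | unfolded => exact absurd rfl hμ
  | inward =>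
    refine ⟨a, h6, fun k => ?_⟩
    by_cases hk : k = a
    · subst hk; simp [h1, hne.symm]
    · by_cases hk' : k = a + 3
      · subst hk'; simp [h2, EdgeMark.reverse, hne]
      · simp [h3 k hk hk', hk, hk']
  | outward =>
    refine ⟨a + 3, h6, fun k => ?_⟩
    rw [h33]
    by_cases hk : k = a
    · subst hk; simp [h1, hne.symm]
    · by_cases hk' : k = a + 3
      · subst hk'; simp [h2, EdgeMark.reverse, hne]
      · simp [h3 k hk hk', hk, hk']

/-! ### Turns at the nodes. -/

variable {S}

lemma turn_straight {w : Z} (h : S.Is60 w) (k : ZMod (X.sectors w)) :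
    S.Turn ⟨w, k⟩ ⟨w, k + 3⟩ := by
  refine Turn.pair w k (k + 3) (fun hk => ?_) (NodeStar.straight k h)
  have h3 : (3 : ZMod (X.sectors w)) = 0 := by simpa using hk
  rw [h.1] at h3
  exact absurd h3 (by decide)

/-- Each of the two directions on one side may be joined to each on the other. The signs `σ` and `ε`
only exchange the sides, which symmetry of `Turn` absorbs. -/
lemma turn_crossing {w : Z} (h : S.Is62 w) {a : ZMod (X.sectors w)}
    (ha : S.mark w a ≠ EdgeMark.unfolded) (σ ε : ℤˣ) {l l' : ℤ} (hl : l = 1 ∨ l = 2)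
    (hl' : l' = 1 ∨ l' = 2) :
    S.Turn ⟨w, frameDir a σ (ε * l)⟩ ⟨w, frameDir a σ (-(ε * l'))⟩ := by
  have h6 : X.sectors w = 6 := by
    obtain ⟨_, h, _⟩ := h
    exact h
  have key : ∀ l l' : ℤ, (l = 1 ∨ l = 2) → (l' = 1 ∨ l' = 2) →
      S.Turn ⟨w, frameDir a 1 l⟩ ⟨w, frameDir a 1 (-l')⟩ := by
    intro l l' hl hl'
    refine Turn.pair w _ _ (fun heq => ?_) (NodeStar.crossing a _ _ h ha ?_ ?_)
    · have := frameDir_injective h6 _ _ heq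
      rcases hl with rfl | rfl <;> rcases hl' with rfl | rfl <;> revert this <;> decide
    · rcases hl with rfl | rfl <;> simp [frameDir, sgn_one]
    · rcases hl' with rfl | rfl <;> simp [frameDir, sgn_one, sub_eq_add_neg]
  have hneg : ∀ l, frameDir a (-1) l = frameDir a 1 (-l) := fun l => by
    simp [frameDir, sgn_one, sgn_neg_one]
  rcases Int.units_eq_one_or σ with rfl | rfl <;> rcases Int.units_eq_one_or ε with rfl | rfl
  · simpa using key l l' hl hl'
  · simpa using (key l' l hl' hl).symm
  · simpa [hneg] using (key l' l hl' hl).symm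
  · simpa [hneg] using key l l' hl hl'

/-- Passages at a node that are always allowed. -/
lemma eventually_turn {z : Z} (hz : X.sectors z = 6) (k : ZMod (X.sectors z)) (σ : ℤˣ) :
    ∀ᶠ h in 𝓝[>] (0 : ℝ), S.Turn (X.nodeGerm z k h (-σ)) (X.nodeGerm z k h (2 * σ)) := by
  -- The directions `-σ` and `2 * σ` are opposite modulo 6: this is going straight, which is also
  -- among the choices at a fold edge.
  by_cases hk : S.mark z k = EdgeMark.unfolded
  · filter_upwards [eventually_node hz k, S.eventually_node_is60 hz k hk] with h h1 h2
    obtain ⟨a, τ, hf, hg⟩ := h1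
    rw [hg, hg]
    have := turn_straight h2 (frameDir a τ (-σ))
    rw [← frameDir_add_three hf.1] at this
    rwa [frameDir_congr hf.1 a τ (l := 2 * σ) (l' := -σ + 3)]
    rcases Int.units_eq_one_or σ with rfl | rfl <;> decide
  · filter_upwards [S.eventually_node_mark hz k] with h h1
    obtain ⟨a, τ, hf, hg, h1, h2, h3⟩ := h1
    rw [hg, hg]
    have := turn_crossing (S.is62_of_marks hf.1 a hk h1 h2 h3) (by rwa [h1]) τ (-σ)
      (Or.inl rfl : (1 : ℤ) = 1 ∨ (1 : ℤ) = 2) (Or.inr rfl : (2 : ℤ) = 1 ∨ (2 : ℤ) = 2)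
    convert this using 3 <;> simp [mul_comm]

/-- The bend of the hexagon at one of its corners, available by refraction only. -/
lemma eventually_turn_middle {z : Z} (hz : X.sectors z = 6) (k : ZMod (X.sectors z))
    (hk : S.mark z k ≠ EdgeMark.unfolded) (σ : ℤˣ) :
    ∀ᶠ h in 𝓝[>] (0 : ℝ), S.Turn (X.nodeGerm z k h (-(2 * σ))) (X.nodeGerm z k h (2 * σ)) := by
  filter_upwards [S.eventually_node_mark hz k] with h h1
  obtain ⟨a, τ, hf, hg, h1, h2, h3⟩ := h1
  rw [hg, hg]
  have := turn_crossing (S.is62_of_marks hf.1 a hk h1 h2 h3) (by rwa [h1]) τ (-σ)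
    (Or.inr rfl : (2 : ℤ) = 1 ∨ (2 : ℤ) = 2) (Or.inr rfl : (2 : ℤ) = 1 ∨ (2 : ℤ) = 2)
  convert this using 3 <;> simp [mul_comm]

/-- A segment from a node to the central point. -/
lemma eventually_seg_center {z : Z} (hz : X.sectors z = 6) (k : ZMod (X.sectors z))
    (hk : S.mark z k = EdgeMark.unfolded) :
    ∀ᶠ h in 𝓝[>] (0 : ℝ), S.Seg (X.nodeGerm z k h 3) ⟨z, k⟩ := by
  obtain ⟨G, hG, hzG, h0, hF, -⟩ := exists_flatChart hz k 1
  have hn := hF.eventually_node 0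
  rw [frameDir_zero] at hn
  have hP : ∀ᶠ h in 𝓝[>] (0 : ℝ), S.Is60 (X.ray z k h) ∧ X.ray z k h ∈ G.source ∧
      G (X.ray z k h) = (h, 0) := by
    filter_upwards [S.eventually_node_is60 hz k hk, hn,
      (tendsto_ray_nhdsGT z k).eventually (G.open_source.mem_nhds hzG)] with h h1 h2 h3
    refine ⟨h1, h3, ?_⟩
    rw [h2.1, h0]
    simp [hexVec_zero]
  obtain ⟨ε, hε, hε'⟩ := mem_nhdsGT_iff_exists_Ioo_subset.1 hP
  filter_upwards [hn, hP, Ioo_mem_nhdsGT hε] with h h1 h2 h3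
  obtain ⟨-, a, σ, hf, hg⟩ := h1
  rw [hg]
  have h5 := hG.segment (P := S.Is60) h2.2.1 hzG 3 h3.1 (by
    rw [h0, h2.2.2]; ext <;> simp [hexVec_three])
    (fun t ht => ?_) hf hF
  · have h6 : frameDir k 1 (3 + 3) = k := by
      rw [frameDir_congr hz k 1 (l' := 0) (by decide), frameDir_zero]
    rw [h6] at h5
    simpa [Seg] using h5
  · have h7 : G (X.ray z k h) + t • hexVec ((3 : ℤ) : ZMod 6) = (h - t, 0) := by
      rw [h2.2.2]; ext <;> simp [hexVec_three, sub_eq_add_neg]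
    rw [h7]
    have h8 := hε' (show h - t ∈ Set.Ioo 0 ε from ⟨by linarith [ht.2], by linarith [ht.1, h3.2]⟩)
    have h9 : G (X.ray z k (h - t)) = (h - t, 0) := h8.2.2
    rw [← h9, G.left_inv h8.2.1]
    exact ⟨G.map_source h8.2.1, h8.1⟩

/-- The two directions are at 120°. At a fold edge they are joined by refraction; otherwise the
third direction of a collision points back to `z`, which is singular and can end the leg. -/
lemma eventually_turn_single {z : Z} (hz : X.sectors z = 6) (hs : S.IsSingular z)
    (k : ZMod (X.sectors z)) (σ : ℤˣ) :
    ∀ᶠ h in 𝓝[>] (0 : ℝ), S.Turn (X.nodeGerm z k h (-σ)) (X.nodeGerm z k h σ) := by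
  by_cases hk : S.mark z k = EdgeMark.unfolded
  · filter_upwards [eventually_node hz k, S.eventually_node_is60 hz k hk,
      eventually_seg_center hz k hk] with h h1 h2 h3
    obtain ⟨a, τ, hf, hg⟩ := h1
    rw [hg] at h3
    rw [hg, hg]
    refine Turn.triple _ _ _ _ _ (fun he => ?_) (fun he => ?_) (fun he => ?_) ?_ h3
      (NodeStar.endpoint k hs hk)
    · have := frameDir_injective hf.1 _ _ he
      rcases Int.units_eq_one_or σ with rfl | rfl <;> revert this <;> decide
    · have := frameDir_injective hf.1 _ _ he
      rcases Int.units_eq_one_or σ with rfl | rfl <;> revert this <;> decide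
    · have := frameDir_injective hf.1 _ _ he
      rcases Int.units_eq_one_or σ with rfl | rfl <;> revert this <;> decide
    · have h4 := NodeStar.collision (S := S) (frameDir a τ 3) h2
      rwa [frameDir_triple hf.1]
  · filter_upwards [S.eventually_node_mark hz k] with h h1
    obtain ⟨a, τ, hf, hg, h1, h2, h3⟩ := h1
    rw [hg, hg]
    have := turn_crossing (S.is62_of_marks hf.1 a hk h1 h2 h3) (by rwa [h1]) τ (-σ)
      (Or.inl rfl : (1 : ℤ) = 1 ∨ (1 : ℤ) = 2) (Or.inl rfl : (1 : ℤ) = 1 ∨ (1 : ℤ) = 2)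
    convert this using 3 <;> simp

end Scaffolding

/-! ### Strips along straight edges. -/

/-- A relation on the points of an interval that holds locally to the left and to the right of
each point, and is transitive, holds between the end points. -/
lemma rel_of_local {R : ℝ → ℝ → Prop} {L : ℝ} (hL : 0 < L)
    (htrans : ∀ x y z, y ∈ Set.Ioo 0 L → R x y → R y z → R x z)
    (hright : ∀ x ∈ Set.Ico 0 L, ∀ᶠ r in 𝓝[>] (0 : ℝ), R x (x + r))
    (hleft : ∀ x ∈ Set.Ioc 0 L, ∀ᶠ r in 𝓝[>] (0 : ℝ), R (x - r) x) : R 0 L := by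
  set A : Set ℝ := {y | y ∈ Set.Ioc 0 L ∧ R 0 y} with hA
  have step : ∀ x ∈ Set.Ico 0 L, ∃ y, x < y ∧ y ∈ Set.Ioc 0 L ∧ R x y := by
    intro x hx
    obtain ⟨r, hr1, hr2⟩ := ((hright x hx).and
      (Ioo_mem_nhdsGT (show 0 < L - x by linarith [hx.2]))).exists
    exact ⟨x + r, by linarith [hr2.1], ⟨by linarith [hr2.1, hx.1], by linarith [hr2.2]⟩, hr1⟩
  obtain ⟨y0, hy0, hy0L, hR0⟩ := step 0 ⟨le_rfl, hL⟩
  have hbdd : BddAbove A := ⟨L, fun y hy => hy.1.2⟩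
  have hne : A.Nonempty := ⟨y0, hy0L, hR0⟩
  set s := sSup A with hs
  have hs0 : 0 < s := lt_of_lt_of_le hy0 (le_csSup hbdd ⟨hy0L, hR0⟩)
  have hsL : s ≤ L := csSup_le hne fun y hy => hy.1.2
  -- The supremum is attained, by the relation on the left of `s`; the relation on the right then
  -- forbids `s < L`.
  have hsA : R 0 s := by
    obtain ⟨ε, hε, hε'⟩ := mem_nhdsGT_iff_exists_Ioo_subset.1 (hleft s ⟨hs0, hsL⟩)
    have hε : 0 < ε := hε
    obtain ⟨y, hyA, hy⟩ := exists_lt_of_lt_csSup hne (show s - ε < sSup A by linarith)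
    rcases (le_csSup hbdd hyA).eq_or_lt with h | h
    · rw [hs, ← h]
      exact hyA.2
    · refine htrans 0 y s ⟨hyA.1.1, lt_of_lt_of_le h hsL⟩ hyA.2 ?_
      have := hε' (show s - y ∈ Set.Ioo 0 ε from ⟨by linarith, by linarith⟩)
      simpa using this
  rcases hsL.eq_or_lt with h | h
  · rwa [← h]
  · obtain ⟨y, hy, hyL, hR⟩ := step s ⟨hs0.le, h⟩
    have : y ∈ A := ⟨hyL, htrans 0 s y ⟨hs0, h⟩ hsA hR⟩
    exact absurd (le_csSup hbdd this) (not_le.2 hy)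

namespace Scaffolding

open Construction

variable {Z : Type*} [TopologicalSpace Z] {X : Construction Z} (S : Scaffolding X)

/-- The hexagon around a flat point. -/
lemma eventually_seg_hexagon {z : Z} (hz : X.sectors z = 6) (k : ZMod (X.sectors z)) (σ : ℤˣ) :
    ∀ᶠ h in 𝓝[>] (0 : ℝ),
      S.Seg (X.nodeGerm z k h (2 * σ)) (X.nodeGerm z (k + sgn _ σ) h (-(2 * σ))) := by
  obtain ⟨G, hG, hzG, h0, hF, r, hr, hbox⟩ := S.exists_sector_chart hz k σ
  have e0 : frameDir k σ 0 = k := frameDir_zero _ _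
  have e1 : frameDir k σ 1 = k + sgn _ σ := by simp [frameDir]
  have hn0 := hF.eventually_node 0
  have hn1 := hF.eventually_node 1
  rw [e0] at hn0
  rw [e1] at hn1
  filter_upwards [hn0, hn1, Ioo_mem_nhdsGT hr,
    (tendsto_ray_nhdsGT z k).eventually (G.open_source.mem_nhds hzG),
    (tendsto_ray_nhdsGT z (k + sgn _ σ)).eventually (G.open_source.mem_nhds hzG)]
    with h h1 h2 h3 h4 h5
  obtain ⟨h1, a, τ, hf, hg⟩ := h1
  obtain ⟨h2, a', τ', hf', hg'⟩ := h2
  rw [hg, hg']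
  have hp : G (X.ray z k h) = (h, 0) := by rw [h1, h0]; ext <;> simp [hexVec_zero]
  have hq : G (X.ray z (k + sgn _ σ) h) = (0, h) := by rw [h2, h0]; ext <;> simp [hexVec_one]
  have hσ : (σ : ℤ) * σ = 1 := by rcases Int.units_eq_one_or σ with rfl | rfl <;> simp
  have := hG.segment (P := S.Is60) h4 h5 2 h3.1
    (by rw [hp, hq]; ext <;> simp [hexVec_two]) (fun t ht => ?_) hf hf'
  · rw [show (0 : ℤ) + σ * (2 * σ) = 2 by linear_combination 2 * hσ,
      show (1 : ℤ) + σ * (-(2 * σ)) = -1 by linear_combination (-2) * hσ,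
      frameDir_congr hf'.1 a' τ' (l := -1) (l' := 2 + 3) (by decide)]
    exact this
  · have e : G (X.ray z k h) + t • hexVec ((2 : ℤ) : ZMod 6) = (h - t, t) := by
      rw [hp]; ext <;> simp [hexVec_two, sub_eq_add_neg]
    rw [e]
    have hb := hbox (h - t, t) (by rw [abs_lt]; constructor <;> linarith [ht.1, ht.2, h3.1, h3.2])
      (by rw [abs_lt]; constructor <;> linarith [ht.1, ht.2, h3.1, h3.2])
    exact ⟨hb.1, hb.2 (by linarith [ht.2]) ht.1⟩

/-- On both sides, at each small distance, there is a path of the spectral network parallel to the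
edge that leaves `z` along `i` and arrives at `w` along `b`. -/
def EdgeStrip (z : Z) (i : ZMod (X.sectors z)) (w : Z) (b : ZMod (X.sectors w)) : Prop :=
  ∃ τ : ℤˣ, ∀ σ : ℤˣ, ∀ᶠ h in 𝓝[>] (0 : ℝ),
    S.Walk (X.nodeGerm z (i + sgn _ σ) h (-σ))
      (X.nodeGerm w (b + sgn _ (τ * σ)) h (-((τ * σ : ℤˣ) : ℤ)))

variable {S}

lemma EdgeStrip.symm {z : Z} {i : ZMod (X.sectors z)} {w : Z} {b : ZMod (X.sectors w)}
    (hs : S.EdgeStrip z i w b) : S.EdgeStrip w b z i := by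
  obtain ⟨τ, hτ⟩ := hs
  refine ⟨τ, fun σ => ?_⟩
  filter_upwards [hτ (τ * σ)] with h hh
  have := hh.symm
  rwa [← mul_assoc, Int.units_mul_self, one_mul] at this

/-- Near `w` the two paths are joined along one side of the hexagon, going straight at both its
nodes. A side has opposite signs when seen from `b` and from `b + 3`, whence the sign in `-(τ' *
τ)`. -/
lemma EdgeStrip.trans {z : Z} {i : ZMod (X.sectors z)} {w : Z} {b : ZMod (X.sectors w)}
    {q : Z} {j : ZMod (X.sectors q)} (hw : X.sectors w = 6)
    (h1 : S.EdgeStrip z i w b) (h2 : S.EdgeStrip w (b + 3) q j) : S.EdgeStrip z i q j := by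
  obtain ⟨τ, hτ⟩ := h1
  obtain ⟨τ', hτ'⟩ := h2
  refine ⟨-(τ' * τ), fun σ => ?_⟩
  have e : b + 3 + sgn _ (-(τ * σ)) = b + sgn _ (τ * σ) + sgn _ (τ * σ) := by
    have := sgn_mul_three hw (τ * σ)
    rw [sgn_neg]
    linear_combination -this
  have e' : -(τ' * τ) * σ = τ' * -(τ * σ) := by simp [mul_assoc]
  have h2 := hτ' (-(τ * σ))
  rw [e, Units.val_neg, neg_neg] at h2
  rw [e']
  filter_upwards [hτ σ, h2, eventually_turn hw (b + sgn _ (τ * σ)) (τ * σ),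
    S.eventually_seg_hexagon hw (b + sgn _ (τ * σ)) (τ * σ),
    eventually_turn (S := S) hw (b + sgn _ (τ * σ) + sgn _ (τ * σ)) (-(τ * σ))] with h h1 h2 h3 h4 h5
  refine (h1.trans h3 (Walk.seg h4)).trans ?_ h2
  have := h5.symm
  simpa using this

/-- Close to a flat point, the strips along an edge exist. -/
lemma eventually_edgeStrip {z : Z} (hz : X.sectors z = 6) (i : ZMod (X.sectors z)) :
    ∀ᶠ t in 𝓝[>] (0 : ℝ), ∀ w, w = X.ray z i t → ∀ b : ZMod (X.sectors w),
      (∀ᶠ r in 𝓝[>] (0 : ℝ), X.ray w b r = X.ray z i (t - r)) → S.EdgeStrip z i w b := by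
  have main : ∀ σ : ℤˣ, ∀ᶠ t in 𝓝[>] (0 : ℝ), ∀ A ρ,
      X.Frame (X.nodeCoord z i) (X.ray z i t) A ρ → ∀ b : ZMod (X.sectors (X.ray z i t)),
      (∀ᶠ r in 𝓝[>] (0 : ℝ), X.ray (X.ray z i t) b r = X.ray z i (t - r)) →
      ∀ᶠ h in 𝓝[>] (0 : ℝ), S.Walk (X.nodeGerm z (i + sgn _ σ) h (-σ))
        (X.nodeGerm (X.ray z i t) (b + sgn _ (-ρ * σ)) h (-((-ρ * σ : ℤˣ) : ℤ))) := by
    intro σ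
    obtain ⟨G, hG, hzG, h0, hF, r, hr, hbox⟩ := S.exists_sector_chart hz i σ
    have e0 : frameDir i σ 0 = i := frameDir_zero _ _
    have e1 : frameDir i σ 1 = i + sgn _ σ := by simp [frameDir]
    have hof := hF.of_node 0
    have hn1 := hF.eventually_node 1
    have hray := hF.map_ray 0
    rw [e0] at hof hray
    rw [e1] at hn1
    replace hray : ∀ᶠ t in 𝓝[>] (0 : ℝ), G (X.ray z i t) = (t, 0) := by
      filter_upwards [hray.filter_mono (nhdsWithin_mono _ Set.Ioi_subset_Ici_self)] with t ht
      rw [ht, h0]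
      ext <;> simp [hexVec_zero]
    filter_upwards [hof, hray, eventually_nhdsGT_shift hray, Ioo_mem_nhdsGT hr,
      (tendsto_ray_nhdsGT z i).eventually (G.open_source.mem_nhds hzG)]
      with t h1 h2 h3 h4 h5 A ρ hA b hb
    have hFw := h1 A ρ hA
    rw [neg_zero, frameDir_zero] at hFw
    -- The germ `b` points back to `z`, that is, in direction 3; the neighbouring germ on the chosen
    -- side then has direction 2.
    have hb3 : b = frameDir A (σ * ρ) 3 := by
      refine hFw.germ_unique 3 ?_
      filter_upwards [hb, h3.2] with s hs hs'
      rw [hs, hs', h2]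
      ext <;> simp [hexVec_three, sub_eq_add_neg]
    have hb2 : b + sgn _ (-ρ * σ) = frameDir A (σ * ρ) 2 := by
      rw [hb3, neg_mul, sgn_neg, mul_comm ρ σ]
      simp only [frameDir]
      push_cast
      ring
    have hn2 := hFw.eventually_node 2
    rw [← hb2] at hn2
    filter_upwards [hn1, hn2, Ioo_mem_nhdsGT hr, Ioo_mem_nhdsGT h4.1,
      (tendsto_ray_nhdsGT z (i + sgn _ σ)).eventually (G.open_source.mem_nhds hzG),
      (tendsto_ray_nhdsGT (X.ray z i t) (b + sgn _ (-ρ * σ))).eventually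
        (G.open_source.mem_nhds h5)] with h k1 k2 k3 k4 k5 k6
    obtain ⟨k1, a, τ, hf, hg⟩ := k1
    obtain ⟨k2, a', τ', hf', hg'⟩ := k2
    rw [hg, hg']
    apply Walk.seg
    have hp : G (X.ray z (i + sgn _ σ) h) = (0, h) := by rw [k1, h0]; ext <;> simp [hexVec_one]
    have hq : G (X.ray (X.ray z i t) (b + sgn _ (-ρ * σ)) h) = (t - h, h) := by
      rw [k2, h2]; ext <;> simp [hexVec_two, sub_eq_add_neg]
    have hσ : (σ : ℤ) * σ = 1 := by rcases Int.units_eq_one_or σ with rfl | rfl <;> simp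
    have hρ : (ρ : ℤ) * ρ = 1 := by rcases Int.units_eq_one_or ρ with rfl | rfl <;> simp
    -- The path is the horizontal segment from `(0, h)` to `(t - h, h)`, inside a single open
    -- sector; it has positive length because `h < t`.
    have key := hG.segment (P := S.Is60) k5 k6 0 (show 0 < t - h by linarith [k4.2])
      (by rw [hp, hq]; ext <;> simp [hexVec_zero]) (fun s hs => ?_) hf hf'
    · rw [show (1 : ℤ) + σ * (-σ) = 0 by linear_combination -hσ,
        show (2 : ℤ) + ((σ * ρ : ℤˣ) : ℤ) * (-((-ρ * σ : ℤˣ) : ℤ)) = 0 + 3 by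
          push_cast; linear_combination (ρ : ℤ) * ρ * hσ + hρ]
      exact key
    · have e : G (X.ray z (i + sgn _ σ) h) + s • hexVec ((0 : ℤ) : ZMod 6) = (s, h) := by
        rw [hp]; ext <;> simp [hexVec_zero]
      rw [e]
      have hb := hbox (s, h)
        (by rw [abs_lt]; constructor <;> linarith [hs.1, hs.2, h4.1, h4.2, k4.1])
        (by rw [abs_lt]; constructor <;> linarith [k3.1, k3.2])
      exact ⟨hb.1, hb.2 hs.1 k3.1⟩
  filter_upwards [main 1, main (-1), eventually_node hz i] with t h1 h2 h3
  rintro w rfl b hb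
  obtain ⟨A, ρ, hA, -⟩ := h3
  refine ⟨-ρ, fun σ => ?_⟩
  rcases Int.units_eq_one_or σ with rfl | rfl
  · exact h1 A ρ hA b hb
  · exact h2 A ρ hA b hb

/-- Strips exist near each point of the segment and can be composed, so `rel_of_local` applies. The
bound on `h` may shrink at each composition, but that argument makes only finitely many. -/
lemma edgeStrip_of_straight {p q : Z} {i : ZMod (X.sectors p)} {j : ZMod (X.sectors q)}
    (hp : X.sectors p = 6) (hq : X.sectors q = 6) {P : ∀ z, ZMod (X.sectors z) → Prop}
    (h : X.Segment P p i q j) : S.EdgeStrip p i q j := by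
  obtain ⟨L, c, hL, h1, h2, h3⟩ := h
  have hc0 : p = c 0 := by
    have := h1.self_of_nhdsWithin (Set.mem_Ici.2 le_rfl)
    rw [this, ray_zero]
  have hcL : q = c L := by
    have := h2.self_of_nhdsWithin (Set.mem_Ici.2 le_rfl)
    rw [sub_zero] at this
    rw [this, ray_zero]
  subst hc0 hcL
  -- Forward and backward germs are chosen for all real `t`; the values not governed by the
  -- conditions are dummies. They are opposite only at interior points, the only ones where strips
  -- are composed.
  have hfwd : ∀ t, ∃ f b : ZMod (X.sectors (c t)),
      (t ∈ Set.Ico 0 L → ∀ᶠ s in 𝓝[≥] (0 : ℝ), c (t + s) = X.ray (c t) f s) ∧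
      (t ∈ Set.Ioc 0 L → ∀ᶠ s in 𝓝[≥] (0 : ℝ), c (t - s) = X.ray (c t) b s) ∧
      (t ∈ Set.Ioo 0 L → f = b + 3) ∧ (t ∈ Set.Icc 0 L → X.sectors (c t) = 6) := by
    intro t
    by_cases ht : t ∈ Set.Ioo 0 L
    · obtain ⟨k, ⟨h6, hk⟩, -⟩ := h3 t ht
      refine ⟨k, k + 3, fun _ => hk.mono fun s hs => hs.1, fun _ => hk.mono fun s hs => hs.2,
        fun _ => ?_, fun _ => h6⟩
      have : (6 : ZMod (X.sectors (c t))) = 0 := by rw [h6]; rfl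
      linear_combination -this
    · by_cases h0 : t = 0
      · subst h0
        refine ⟨i, i, fun _ => by simpa using h1, fun h => absurd h.1 (lt_irrefl _),
          fun h => absurd h ht, fun _ => hp⟩
      · by_cases h0 : t = L
        · subst h0
          refine ⟨j, j, fun h => absurd h.2 (lt_irrefl _), fun _ => h2,
            fun h => absurd h ht, fun _ => hq⟩
        · have hn : t ∉ Set.Icc 0 L := fun h => ht ⟨lt_of_le_of_ne h.1 (Ne.symm ‹¬ t = 0›),
            lt_of_le_of_ne h.2 h0⟩
          exact ⟨0, 0, fun h => absurd ⟨h.1, h.2.le⟩ hn, fun h => absurd ⟨h.1.le, h.2⟩ hn,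
            fun h => absurd h ht, fun h => absurd h hn⟩
  choose f b hf hb hfb h6 using hfwd
  have hi : f 0 = i := by
    apply ray_injective
    have := hf 0 ⟨le_rfl, hL⟩
    filter_upwards [this.filter_mono (nhdsWithin_mono _ Set.Ioi_subset_Ici_self),
      h1.filter_mono (nhdsWithin_mono _ Set.Ioi_subset_Ici_self)] with s hs hs'
    rw [← hs, zero_add, hs']
  have hj : b L = j := by
    apply ray_injective
    have := hb L ⟨hL, le_rfl⟩
    filter_upwards [this.filter_mono (nhdsWithin_mono _ Set.Ioi_subset_Ici_self),
      h2.filter_mono (nhdsWithin_mono _ Set.Ioi_subset_Ici_self)] with s hs hs'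
    rw [← hs, hs']
  have key := rel_of_local (R := fun x y => S.EdgeStrip (c x) (f x) (c y) (b y)) hL
    (fun x y z hy hxy hyz => ?_) (fun x hx => ?_) (fun x hx => ?_)
  · rw [hi, hj] at key
    exact key
  · have hyz : S.EdgeStrip (c y) (f y) (c z) (b z) := hyz
    rw [hfb y hy] at hyz
    exact EdgeStrip.trans (h6 y ⟨hy.1.le, hy.2.le⟩) hxy hyz
  · have hx' := (hf x hx).filter_mono (nhdsWithin_mono _ Set.Ioi_subset_Ici_self)
    filter_upwards [eventually_edgeStrip (h6 x ⟨hx.1, hx.2.le⟩) (f x), hx',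
      eventually_nhdsGT_shift hx', Ioo_mem_nhdsGT (show 0 < L - x by linarith [hx.2])]
      with t k1 k2 k3 k4
    apply k1 _ k2
    have := hb (x + t) ⟨by linarith [k4.1, hx.1], by linarith [k4.2]⟩
    filter_upwards [this.filter_mono (nhdsWithin_mono _ Set.Ioi_subset_Ici_self), k3.2]
      with s hs hs'
    rw [← hs, ← hs']
    congr 1
    ring
  · have hx' := (hb x hx).filter_mono (nhdsWithin_mono _ Set.Ioi_subset_Ici_self)
    filter_upwards [eventually_edgeStrip (h6 x ⟨hx.1.le, hx.2⟩) (b x), hx',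
      eventually_nhdsGT_shift hx', Ioo_mem_nhdsGT hx.1]
      with t k1 k2 k3 k4
    apply EdgeStrip.symm
    apply k1 _ k2
    have := hf (x - t) ⟨by linarith [k4.2], by linarith [k4.1, hx.2]⟩
    filter_upwards [this.filter_mono (nhdsWithin_mono _ Set.Ioi_subset_Ici_self), k3.2]
      with s hs hs'
    rw [← hs, ← hs']
    congr 1
    ring

end Scaffolding

/-! ### Closed paths and BPS states. -/

lemma exists_seq_of_transGen {α : Type*} {r : α → α → Prop} {a b : α}
    (h : Relation.TransGen r a b) :
    ∃ n : ℕ, ∃ g : ℕ → α, g 0 = a ∧ g (n + 1) = b ∧ ∀ k ≤ n, r (g k) (g (k + 1)) := by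
  induction h with
  | @single b h => exact ⟨0, fun k => if k = 0 then a else b, by simp, by simp, fun k hk => by
      obtain rfl : k = 0 := by omega
      simpa using h⟩
  | @tail b c _ hbc ih =>
    obtain ⟨n, g, h0, hn, hg⟩ := ih
    refine ⟨n + 1, fun k => if k ≤ n + 1 then g k else c, by simpa using h0, by simp,
      fun k hk => ?_⟩
    by_cases hk' : k = n + 1
    · subst hk'
      simpa [hn] using hbc
    · have h1 : k ≤ n + 1 := by omega
      have h2 : k + 1 ≤ n + 1 := by omega
      simp only [h1, h2, if_true]
      exact hg k (by omega)

/-- A closed path of a relation, as a family indexed by a cyclic group. -/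
lemma exists_cycle_of_transGen {α : Type*} {r : α → α → Prop} {a : α}
    (h : Relation.TransGen r a a) :
    ∃ n : ℕ, ∃ f : ZMod (n + 1) → α, ∀ i, r (f i) (f (i + 1)) := by
  obtain ⟨n, g, h0, hn, hg⟩ := exists_seq_of_transGen h
  refine ⟨n, fun i => g i.val, fun i => ?_⟩
  have hi := ZMod.val_lt i
  have h1 := hg i.val (by omega)
  change r (g i.val) (g (i + 1).val)
  by_cases hlt : i.val = n
  · have : (i + 1).val = 0 := by
      rw [ZMod.val_add, ZMod.val_one_eq_one_mod, Nat.add_mod_mod, hlt, Nat.mod_self]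
    rw [this, h0, ← hn]
    rwa [hlt] at h1 ⊢
  · have : (i + 1).val = i.val + 1 := by
      rw [ZMod.val_add, ZMod.val_one_eq_one_mod, Nat.add_mod_mod, Nat.mod_eq_of_lt (by omega)]
    rwa [this]

/-- Without a periodic point, reachability would be a strict order on a finite set, and a minimal
element would contradict the existence of its image. -/
lemma exists_transGen_self {α : Type*} [Finite α] [Nonempty α] (f : α → α) :
    ∃ a, Relation.TransGen (fun x y => f x = y) a a := by
  by_contra! h
  let r : α → α → Prop := fun x y => Relation.TransGen (fun x y => f x = y) y x
  have : IsTrans α r := ⟨fun _ _ _ h1 h2 => h2.trans h1⟩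
  have : Std.Irrefl r := ⟨h⟩
  have hwf : WellFounded r := Finite.wellFounded_of_trans_of_irrefl r
  obtain ⟨m, -, hm⟩ := hwf.has_min Set.univ Set.univ_nonempty
  exact hm (f m) trivial (Relation.TransGen.single rfl)

namespace Scaffolding

open Construction

variable {Z : Type*} [TopologicalSpace Z] {X : Construction Z} {S : Scaffolding X}

variable (S) in
/-- Going from a germ along a straight segment, and turning at its end. -/
def Step (g g' : X.Germ) : Prop := ∃ m, S.Seg g m ∧ S.Turn m g'

lemma Walk.transGen_step {g m g' : X.Germ} (h : S.Walk g m) (ht : S.Turn m g') :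
    Relation.TransGen S.Step g g' := by
  induction h generalizing g' with
  | seg h => exact Relation.TransGen.single ⟨_, h, ht⟩
  | trans _ ht' _ ih1 ih2 => exact (ih1 ht').trans (ih2 ht)

/-- A BPS state with set of half-edges `E`. -/
lemma nonempty_bpsState_of_halfEdges {V E : Type} [Finite V] [Nonempty V] (pos : V → Z)
    (half : E → Σ v, ZMod (X.sectors (pos v))) (hinj : Function.Injective half)
    (hstar : ∀ v, S.NodeStar (pos v) {d | ∃ e, half e = ⟨v, d⟩})
    (mate : E → E) (hmate : ∀ e, mate (mate e) = e) (hne : ∀ e, mate e ≠ e)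
    (hseg : ∀ e, S.Seg ⟨pos (half e).1, (half e).2⟩ ⟨pos (half (mate e)).1, (half (mate e)).2⟩) :
    Nonempty S.BPSState := by
  let star : ∀ v, Set (ZMod (X.sectors (pos v))) := fun v => {d | ∃ e, half e = ⟨v, d⟩}
  let φ : E → Σ v, star v := fun e => ⟨(half e).1, ⟨(half e).2, e, rfl⟩⟩
  -- Stars are sets of germs, so injectivity of `half` is what prevents two half-edges at a node
  -- from being identified.
  have hφ : Function.Bijective φ := by
    constructor
    · intro e e' h
      apply hinj
      have := congrArg (fun x : (Σ v, star v) =>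
        (⟨x.1, x.2.1⟩ : Σ v, ZMod (X.sectors (pos v)))) h
      exact this
    · rintro ⟨v, d, e, he⟩
      refine ⟨e, ?_⟩
      have h1 : v = (half e).1 := by rw [he]
      subst h1
      have h2 : d = (half e).2 := by
        have := he
        rw [Sigma.ext_iff] at this
        exact (eq_of_heq this.2).symm
      subst h2
      rfl
  let Φ := Equiv.ofBijective φ hφ
  have hmate' : ∀ e, Φ (mate (Φ.symm (Φ e))) = φ (mate e) := fun e => by
    rw [Equiv.symm_apply_apply]; rfl
  refine ⟨⟨V, inferInstance, inferInstance, pos, star, hstar, fun x => Φ (mate (Φ.symm x)),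
    fun x => by simp [hmate], fun x hx => hne (Φ.symm x) ?_, fun x => ?_⟩⟩
  · rw [← Φ.symm_apply_apply (mate (Φ.symm x)), hx]
  · obtain ⟨e, rfl⟩ := Φ.surjective x
    rw [hmate' e]
    exact hseg e

/-- A closed path of the spectral network is part of a BPS state. -/
lemma nonempty_bpsState_of_cycle {n : ℕ} (w : ZMod (n + 1) → Z)
    (k l : ∀ t, ZMod (X.sectors (w t)))
    (hseg : ∀ t, S.Seg ⟨w t, l t⟩ ⟨w (t + 1), k (t + 1)⟩) (hkl : ∀ t, k t ≠ l t)
    (C : Set (ZMod (n + 1))) (hpair : ∀ t ∉ C, S.NodeStar (w t) {k t, l t})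
    (m : ∀ t : C, ZMod (X.sectors (w t))) (hkm : ∀ t : C, k t ≠ m t) (hlm : ∀ t : C, l t ≠ m t)
    (htriple : ∀ t : C, S.NodeStar (w t) {k t, l t, m t})
    (g : C → X.Germ) (hg : ∀ t : C, S.Seg ⟨w t, m t⟩ (g t))
    (hend : ∀ t, S.NodeStar (g t).1 {(g t).2}) :
    Nonempty S.BPSState := by
  let pos : ZMod (n + 1) ⊕ C → Z := Sum.elim w (fun t => (g t).1)
  obtain ⟨half, e1, e2, e3, e4⟩ :
      ∃ half : (ZMod (n + 1) × Bool) ⊕ (C × Bool) → Σ v, ZMod (X.sectors (pos v)),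
      (∀ t, half (Sum.inl (t, true)) = ⟨Sum.inl t, l t⟩) ∧
      (∀ t, half (Sum.inl (t, false)) = ⟨Sum.inl t, k t⟩) ∧
      (∀ t : C, half (Sum.inr (t, true)) = ⟨Sum.inl t, m t⟩) ∧
      (∀ t : C, half (Sum.inr (t, false)) = ⟨Sum.inr t, (g t).2⟩) :=
    ⟨fun e => match e with
      | Sum.inl (t, true) => ⟨Sum.inl t, l t⟩
      | Sum.inl (t, false) => ⟨Sum.inl t, k t⟩
      | Sum.inr (t, true) => ⟨Sum.inl t, m t⟩
      | Sum.inr (t, false) => ⟨Sum.inr t, (g t).2⟩,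
      fun _ => rfl, fun _ => rfl, fun _ => rfl, fun _ => rfl⟩
  -- `true` marks the half-edge leaving a node of the cycle, or the start of a tail. Since `mate`
  -- flips this flag it has no fixed point, even on a cycle of length one.
  let mate : (ZMod (n + 1) × Bool) ⊕ (C × Bool) → (ZMod (n + 1) × Bool) ⊕ (C × Bool) := fun e =>
    match e with
    | Sum.inl (t, true) => Sum.inl (t + 1, false)
    | Sum.inl (t, false) => Sum.inl (t - 1, true)
    | Sum.inr (t, b) => Sum.inr (t, !b)
  refine nonempty_bpsState_of_halfEdges pos half ?_ ?_ mate ?_ ?_ ?_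
  · rintro (⟨t, _ | _⟩ | ⟨t, _ | _⟩) (⟨s, _ | _⟩ | ⟨s, _ | _⟩) h <;>
    simp only [e1, e2, e3, e4] at h <;>
    obtain ⟨h1, h2⟩ := Sigma.mk.inj h
    · rw [Sum.inl.inj h1]
    · obtain rfl := Sum.inl.inj h1
      exact absurd (eq_of_heq h2) (hkl _)
    · exact absurd h1 Sum.inl_ne_inr
    · obtain rfl := Sum.inl.inj h1
      exact absurd (eq_of_heq h2) (hkm _)
    · obtain rfl := Sum.inl.inj h1
      exact absurd (eq_of_heq h2).symm (hkl _)
    · rw [Sum.inl.inj h1]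
    · exact absurd h1 Sum.inl_ne_inr
    · obtain rfl := Sum.inl.inj h1
      exact absurd (eq_of_heq h2) (hlm _)
    · exact absurd h1 Sum.inr_ne_inl
    · exact absurd h1 Sum.inr_ne_inl
    · rw [Sum.inr.inj h1]
    · exact absurd h1 Sum.inr_ne_inl
    · obtain rfl := Sum.inl.inj h1
      exact absurd (eq_of_heq h2).symm (hkm _)
    · obtain rfl := Sum.inl.inj h1
      exact absurd (eq_of_heq h2).symm (hlm _)
    · exact absurd h1 Sum.inl_ne_inr
    · rw [Subtype.ext (Sum.inl.inj h1)]
  · rintro (t | t)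
    · by_cases ht : t ∈ C
      · refine Eq.mpr (congrArg (S.NodeStar (w t)) ?_) (htriple ⟨t, ht⟩)
        ext d
        rw [Set.mem_ofPred_eq]
        constructor
        · rintro ⟨(⟨s, _ | _⟩ | ⟨s, _ | _⟩), h⟩ <;> simp only [e1, e2, e3, e4] at h <;>
          obtain ⟨h1, h2⟩ := Sigma.mk.inj h
          · obtain rfl := Sum.inl.inj h1
            exact Or.inl (eq_of_heq h2).symm
          · obtain rfl := Sum.inl.inj h1
            exact Or.inr (Or.inl (eq_of_heq h2).symm)
          · exact absurd h1 Sum.inr_ne_inl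
          · obtain rfl := Sum.inl.inj h1
            exact Or.inr (Or.inr (eq_of_heq h2).symm)
        · rintro (rfl | rfl | rfl)
          · exact ⟨Sum.inl (t, false), e2 t⟩
          · exact ⟨Sum.inl (t, true), e1 t⟩
          · exact ⟨Sum.inr (⟨t, ht⟩, true), e3 ⟨t, ht⟩⟩
      · refine Eq.mpr (congrArg (S.NodeStar (w t)) ?_) (hpair t ht)
        ext d
        rw [Set.mem_ofPred_eq]
        constructor
        · rintro ⟨(⟨s, _ | _⟩ | ⟨s, _ | _⟩), h⟩ <;> simp only [e1, e2, e3, e4] at h <;>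
          obtain ⟨h1, h2⟩ := Sigma.mk.inj h
          · obtain rfl := Sum.inl.inj h1
            exact Or.inl (eq_of_heq h2).symm
          · obtain rfl := Sum.inl.inj h1
            exact Or.inr (eq_of_heq h2).symm
          · exact absurd h1 Sum.inr_ne_inl
          · obtain rfl := Sum.inl.inj h1
            exact absurd s.2 ht
        · rintro (rfl | rfl)
          · exact ⟨Sum.inl (t, false), e2 t⟩
          · exact ⟨Sum.inl (t, true), e1 t⟩
    · refine Eq.mpr (congrArg (S.NodeStar (g t).1) ?_) (hend t)
      ext d
      rw [Set.mem_ofPred_eq]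
      constructor
      · rintro ⟨(⟨s, _ | _⟩ | ⟨s, _ | _⟩), h⟩ <;> simp only [e1, e2, e3, e4] at h <;>
        obtain ⟨h1, h2⟩ := Sigma.mk.inj h
        · exact absurd h1 Sum.inl_ne_inr
        · exact absurd h1 Sum.inl_ne_inr
        · obtain rfl := Sum.inr.inj h1
          exact (eq_of_heq h2).symm
        · exact absurd h1 Sum.inl_ne_inr
      · rintro rfl
        exact ⟨Sum.inr (t, false), e4 t⟩
  · rintro (⟨t, _ | _⟩ | ⟨t, _ | _⟩) <;> simp [mate]
  · rintro (⟨t, _ | _⟩ | ⟨t, _ | _⟩) <;> simp [mate]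
  · rintro (⟨t, _ | _⟩ | ⟨t, _ | _⟩)
    · obtain ⟨s, rfl⟩ : ∃ s, t = s + 1 := ⟨t - 1, by ring⟩
      have : mate (Sum.inl (s + 1, false)) = Sum.inl (s, true) := by simp [mate]
      rw [this, e1, e2]
      exact (hseg s).symm
    · change S.Seg _ ⟨pos (half (Sum.inl (t + 1, false))).1, (half (Sum.inl (t + 1, false))).2⟩
      rw [e1, e2]
      exact hseg t
    · change S.Seg _ ⟨pos (half (Sum.inr (t, true))).1, (half (Sum.inr (t, true))).2⟩
      rw [e3, e4]
      exact (hg t).symm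
    · change S.Seg _ ⟨pos (half (Sum.inr (t, false))).1, (half (Sum.inr (t, false))).2⟩
      rw [e3, e4]
      exact hg t

lemma Turn.cases {g g' : X.Germ} (h : S.Turn g g') : ∃ w k l, g = ⟨w, k⟩ ∧ g' = ⟨w, l⟩ ∧ k ≠ l ∧
    (S.NodeStar w {k, l} ∨ ∃ m, ∃ e : X.Germ, k ≠ m ∧ l ≠ m ∧ S.NodeStar w {k, l, m} ∧
      S.Seg ⟨w, m⟩ e ∧ S.NodeStar e.1 {e.2}) := by
  rcases h with ⟨w, k, l, hkl, hn⟩ | ⟨w, k, l, m, g, hkl, hkm, hlm, hn, hs, hg⟩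
  · exact ⟨w, k, l, rfl, rfl, hkl, Or.inl hn⟩
  · exact ⟨w, k, l, rfl, rfl, hkl, Or.inr ⟨m, g, hkm, hlm, hn, hs, hg⟩⟩

/-- The set `C` consists of the turns that are not a node by themselves, and each of these receives
its third leg. -/
lemma nonempty_bpsState_of_transGen {g : X.Germ} (h : Relation.TransGen S.Step g g) :
    Nonempty S.BPSState := by
  obtain ⟨n, f, hf⟩ := exists_cycle_of_transGen h
  choose p hp ht using hf
  choose w k l h1 h2 hkl hor using fun t => (ht t).cases
  have hseg : ∀ t, S.Seg ⟨w t, l t⟩ ⟨w (t + 1), k (t + 1)⟩ := fun t => by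
    rw [← h1, ← h2]
    exact hp (t + 1)
  have htr : ∀ t : {t | ¬ S.NodeStar (w t) {k t, l t}}, ∃ m, ∃ e : X.Germ, k t ≠ m ∧ l t ≠ m ∧
      S.NodeStar (w t) {k t, l t, m} ∧ S.Seg ⟨w t, m⟩ e ∧ S.NodeStar e.1 {e.2} :=
    fun t => (hor t).resolve_left t.2
  choose m e hkm hlm h3 h4 h5 using htr
  exact nonempty_bpsState_of_cycle w k l hseg hkl _ (fun t ht => not_not.1 ht) m hkm hlm h3 e h4 h5

/-! ### Passage through flat singularities. -/

/-- A path of the spectral network parallel to a fold edge arriving at the singularity `z` along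
`j` can be continued parallel to the fold edge leaving along `i`. -/
lemma eventually_passage {z : Z} (hz : X.sectors z = 6) (hs : S.IsSingular z)
    {j i : ZMod (X.sectors z)}
    (hij : i = j + 3 ∨ ∃ ρ : ℤˣ, i = j + 2 * sgn _ ρ ∧
      S.mark z (j - 2 * sgn _ ρ) ≠ EdgeMark.unfolded) (σ : ℤˣ) :
    ∀ᶠ h in 𝓝[>] (0 : ℝ), ∀ g, S.Walk g (X.nodeGerm z (j + sgn _ σ) h (-σ)) →
      Relation.TransGen S.Step g (X.nodeGerm z (i - sgn _ σ) h σ) := by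
  have h3 := sgn_mul_three hz σ
  have h6 : (6 : ZMod (X.sectors z)) = 0 := by rw [hz]; rfl
  have hfirst : ∀ᶠ h in 𝓝[>] (0 : ℝ), ∀ g, S.Walk g (X.nodeGerm z (j + sgn _ σ) h (-σ)) →
      S.Walk g (X.nodeGerm z (j + sgn _ σ + sgn _ σ) h (-(2 * σ))) := by
    filter_upwards [eventually_turn (S := S) hz (j + sgn _ σ) σ,
      S.eventually_seg_hexagon hz (j + sgn _ σ) σ] with h h1 h2 g hg
    exact hg.trans h1 (Walk.seg h2)
  have hlast : ∀ k : ZMod (X.sectors z), ∀ᶠ h in 𝓝[>] (0 : ℝ),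
      S.Turn (X.nodeGerm z k h (-(2 * σ))) (X.nodeGerm z k h σ) := fun k => by
    filter_upwards [eventually_turn (S := S) hz k (-σ)] with h h1
    simpa using h1.symm
  rcases hij with rfl | ⟨ρ, rfl, hρ⟩
  · have e : j + 3 - sgn _ σ = j + sgn _ σ + sgn _ σ := by linear_combination -h3
    rw [e]
    filter_upwards [hfirst, hlast (j + sgn _ σ + sgn _ σ)] with h h1 h2 g hg
    exact (h1 g hg).transGen_step h2
  -- If `ρ = σ` the path is inside the angle and meets one node only. Otherwise it is outside and
  -- visits three nodes, bending at the middle one, which lies on the fold edge `j - 2ρ`.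
  · by_cases hσ : ρ = σ
    · subst hσ
      have e : j + 2 * sgn _ ρ - sgn _ ρ = j + sgn _ ρ := by ring
      rw [e]
      filter_upwards [eventually_turn_single hz hs (j + sgn _ ρ) ρ] with h h1 g hg
      exact hg.transGen_step h1
    · obtain rfl : ρ = -σ := by
        rcases Int.units_eq_one_or σ with rfl | rfl <;>
        rcases Int.units_eq_one_or ρ with rfl | rfl <;> simp_all
      rw [sgn_neg] at hρ ⊢
      have e : j + 2 * -sgn _ σ - sgn _ σ = j + sgn _ σ + sgn _ σ + sgn _ σ := by
        linear_combination (-sgn _ σ) * h6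
      have e' : j - 2 * -sgn _ σ = j + sgn _ σ + sgn _ σ := by ring
      rw [e]
      rw [e'] at hρ
      filter_upwards [hfirst, eventually_turn_middle hz (j + sgn _ σ + sgn _ σ) hρ σ,
        S.eventually_seg_hexagon hz (j + sgn _ σ + sgn _ σ) σ,
        hlast (j + sgn _ σ + sgn _ σ + sgn _ σ)] with h h1 h2 h3 h4 g hg
      exact ((h1 g hg).trans h2 (Walk.seg h3)).transGen_step h4

lemma Is64.isSingular {z : Z} (h : S.Is64 z) : S.IsSingular z := by
  obtain ⟨a, s, hs, h6, h⟩ := h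
  constructor
  · rintro ⟨-, h0⟩
    have h1 := (h a).1.2 (Or.inl rfl)
    exact ((h0 a).1.1 h1).elim
  · rintro ⟨b, -, h0⟩
    have h1 := (h0 a).1.1 ((h a).1.2 (Or.inl rfl))
    have h2 := (h0 (a + 2 * s)).1.1 ((h (a + 2 * s)).1.2 (Or.inr rfl))
    have h3 : a + 2 * s = a := h2.trans h1.symm
    have h4 : 2 * s = 0 := by simpa using h3
    clear h0 h h1 h2 h3
    revert s
    rw [h6]
    decide

lemma HasPicture.folded {z : Z} {n : ℕ} {I O : Set (ZMod (X.sectors z))}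
    (h : S.HasPicture z n I O) (k : ZMod (X.sectors z)) :
    S.mark z k ≠ EdgeMark.unfolded ↔ k ∈ I ∨ k ∈ O := by
  rw [← (h.2 k).1, ← (h.2 k).2]
  cases S.mark z k <;> simp

variable (S) in
/-- The combinatorial condition on an inward edge `j` and an outward edge `i` at a flat singularity
for paths of the spectral network to follow both on either side. -/
def Follows (z : Z) (j i : ZMod (X.sectors z)) : Prop :=
  X.sectors z = 6 ∧ S.IsSingular z ∧ (i = j + 3 ∨ ∃ ρ : ℤˣ, i = j + 2 * sgn _ ρ ∧
      S.mark z (j - 2 * sgn _ ρ) ≠ EdgeMark.unfolded)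

/-- Only 6₃ has edges of both orientations here. Its outward edge is at 120° from either inward
edge, and the other inward edge is the fold on which the outer path bends. -/
lemma follows_of_not_is64 (hstd : S.IsStandard) {z : Z} (hs : S.IsSingular z) (h64 : ¬ S.Is64 z)
    {j i : ZMod (X.sectors z)} (hj : S.mark z j = EdgeMark.inward)
    (hi : S.mark z i = EdgeMark.outward) : S.Follows z j i := by
  rcases hstd z with h | h | h | h | h | h | h | h | h
  · exact absurd h hs.1
  · exact absurd h hs.2
  · obtain ⟨a, hp⟩ := h
    have h6 : (6 : ZMod (X.sectors z)) = 0 := by rw [hp.1]; rfl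
    have hj' := (hp.2 j).1.1 hj
    have hi' : i = a + 4 := (hp.2 i).2.1 hi
    refine ⟨hp.1, hs, Or.inr ?_⟩
    rcases hj' with rfl | hj'
    · refine ⟨-1, ?_, ?_⟩
      · rw [sgn_neg_one, hi']
        linear_combination h6
      · rw [hp.folded, sgn_neg_one]
        left; right
        simp
    · have hj' : j = a + 2 := hj'
      subst hj'
      refine ⟨1, ?_, ?_⟩
      · rw [sgn_one, hi']
        ring
      · rw [hp.folded, sgn_one]
        left; left
        ring
  · exact absurd h h64
  · exact ((h.2 j).1.1 hj).elim
  · obtain ⟨a, h⟩ := h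
    exact ((h.2 j).1.1 hj).elim
  · obtain ⟨a, h⟩ := h
    exact ((h.2 j).1.1 hj).elim
  · obtain ⟨a, h⟩ := h
    exact ((h.2 j).1.1 hj).elim
  · obtain ⟨a, h⟩ := h
    exact ((h.2 i).2.1 hi).elim

lemma zmod_six_branch {m : ℕ} (hm : m = 6) (a s : ZMod m) (hs : s = 1 ∨ s = -1) :
    a + 2 * s + 3 ≠ a ∧ a + 2 * s + 3 ≠ a + 2 * s ∧ a + 2 * s + 3 ≠ a + 3 ∧
      a + 2 * s + 3 ≠ a - 2 * s ∧ a - 2 * s + 3 ≠ a ∧ a - 2 * s + 3 ≠ a + 2 * s ∧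
      a - 2 * s + 3 ≠ a + 3 ∧ a - 2 * s + 3 ≠ a - 2 * s ∧ a - 2 * s = a + 2 * s + 2 * s ∧
      a + 3 + 3 = a := by
  subst hm
  revert a s
  decide

lemma Is64.follows_spine {z : Z} (h64 : S.Is64 z) {j i : ZMod (X.sectors z)}
    (hj : S.mark z j = EdgeMark.inward) (hi : S.mark z i = EdgeMark.outward)
    (hcj : S.mark z (j + 3) ≠ EdgeMark.unfolded) (hci : S.mark z (i + 3) ≠ EdgeMark.unfolded) :
    S.Follows z j i := by
  have hsing := h64.isSingular
  obtain ⟨a, s, hs, hp⟩ := h64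
  refine ⟨hp.1, hsing, Or.inl ?_⟩
  obtain ⟨k1, k2, k3, k4, k5, k6, k7, k8, k9, k10⟩ := zmod_six_branch hp.1 a s hs
  rw [hp.folded] at hcj hci
  have hj' : j = a ∨ j = a + 2 * s := (hp.2 j).1.1 hj
  have hi' : i = a + 3 ∨ i = a - 2 * s := (hp.2 i).2.1 hi
  simp only [Set.mem_insert_iff, Set.mem_singleton_iff] at hcj hci
  rcases hj' with rfl | rfl
  · rcases hi' with rfl | rfl
    · rfl
    · tauto
  · tauto

/-- The branch edges are at 120°, and the inward half of the spine is the fold on which the outer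
path bends. -/
lemma Is64.follows_branch {z : Z} (h64 : S.Is64 z) {j i : ZMod (X.sectors z)}
    (hj : S.mark z j = EdgeMark.inward) (hi : S.mark z i = EdgeMark.outward)
    (hcj : S.mark z (j + 3) = EdgeMark.unfolded) (hci : S.mark z (i + 3) = EdgeMark.unfolded) :
    S.Follows z j i := by
  have hsing := h64.isSingular
  obtain ⟨a, s, hs, hp⟩ := h64
  refine ⟨hp.1, hsing, Or.inr ?_⟩
  obtain ⟨k1, k2, k3, k4, k5, k6, k7, k8, k9, k10⟩ := zmod_six_branch hp.1 a s hs
  rw [← not_ne_iff, hp.folded] at hcj hci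
  have hj' : j = a ∨ j = a + 2 * s := (hp.2 j).1.1 hj
  have hi' : i = a + 3 ∨ i = a - 2 * s := (hp.2 i).2.1 hi
  simp only [Set.mem_insert_iff, Set.mem_singleton_iff] at hcj hci
  rcases hj' with rfl | rfl
  · tauto
  · rcases hi' with rfl | rfl
    · tauto
    · obtain ⟨ρ, rfl⟩ := exists_sgn_eq hs
      refine ⟨ρ, k9, ?_⟩
      rw [hp.folded]
      left; left
      ring

/-- Fold edges attached to the same vertex follow each other. -/
lemma Vertex.follows (hstd : S.IsStandard) (v : S.Vertex) {j i : ZMod (X.sectors v.pos)}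
    (hj : S.mark v.pos j = EdgeMark.inward) (hi : S.mark v.pos i = EdgeMark.outward)
    (hcj : v.Carries j) (hci : v.Carries i) : S.Follows v.pos j i := by
  cases v with
  | point z hs h64 => exact follows_of_not_is64 hstd hs h64 hj hi
  | spine z h64 => exact h64.follows_spine hj hi hcj hci
  | branch z h64 => exact h64.follows_branch hj hi hcj hci

end Scaffolding

end SpectralNetwork

end

/-! ### Closing a path around a directed loop. -/

theorem proposition6p1 {Z : Type*} [TopologicalSpace Z] [T2Space Z]
    (X : SpectralNetwork.Construction Z) (S : SpectralNetwork.Scaffolding X)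
    (hstd : S.IsStandard) (hBPS : IsEmpty S.BPSState) :
    ∀ v : S.Vertex, ¬ Relation.TransGen S.foldGraph.Adj v v := by
  intro v hv
  obtain ⟨n, f, hf⟩ := SpectralNetwork.exists_cycle_of_transGen hv
  choose o j hco hcj hfold using hf
  have hvert := fun t =>
    (f (t + 1)).follows hstd (hfold t).2.1 (hfold (t + 1)).1 (hcj t) (hco (t + 1))
  have hflat : ∀ t, X.sectors (f t).pos = 6 := fun t => by
    have := (hvert (t - 1)).1
    rwa [sub_add_cancel] at this
  have hstrip : ∀ t, S.EdgeStrip (f t).pos (o t) (f (t + 1)).pos (j t) := fun t =>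
    SpectralNetwork.Scaffolding.edgeStrip_of_straight (hflat t) (hflat (t + 1)) (hfold t).2.2
  choose τ hτ using hstrip
  have hpass := fun t σ => SpectralNetwork.Scaffolding.eventually_passage (hflat (t + 1)) (hvert t).2.1 (hvert t).2.2 σ
  -- One distance for all edges and both sides, as there are finitely many pairs.
  obtain ⟨h, hh1, hh2⟩ := ((eventually_all.2 fun x : ZMod (n + 1) × ℤˣ => hτ x.1 x.2).and
    (eventually_all.2 fun x : ZMod (n + 1) × ℤˣ => hpass x.1 x.2)).exists
  let D : ZMod (n + 1) × ℤˣ → X.Germ := fun x =>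
    X.nodeGerm (f x.1).pos (o x.1 + SpectralNetwork.sgn _ x.2) h (-x.2)
  -- The strip transports the side by `τ`; the sign changes because the path leaves next to `i - σ`
  -- after arriving next to `j + σ`.
  let next : ZMod (n + 1) × ℤˣ → ZMod (n + 1) × ℤˣ := fun x => (x.1 + 1, -(τ x.1 * x.2))
  have hnext : ∀ x, Relation.TransGen S.Step (D x) (D (next x)) := fun x => by
    have := hh2 (x.1, τ x.1 * x.2) _ (hh1 x)
    simpa [D, next, SpectralNetwork.sgn_neg, sub_eq_add_neg] using this
  obtain ⟨x, hx⟩ := SpectralNetwork.exists_transGen_self next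
  have hcycle : Relation.TransGen S.Step (D x) (D x) :=
    Relation.TransGen.lift' (r := fun y z => next y = z) D (fun a b hab => hab ▸ hnext a) x x hx
  exact hBPS.false (SpectralNetwork.Scaffolding.nonempty_bpsState_of_transGen hcycle).some
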